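/- A continuous time random walk starting at $x\in\mathbb Z$ is a process $X(t)=x+N_1(t)-N_2(t)$, $t\ge 0$, where $N_1,N_2$ are independent Poisson processes of rate $1/2$. Let $X_1(t),\dots,X_{n+2}(t)$ be independent continuous time random walks starting at $X_j(0)=x_j=j$, $1\le j\le n+2$. Let $y_k=k$ for $1\le k\le n$, and let $y_{n+1},y_{n+2}$ be integers with $n<y_{n+1}<y_{n+2}$; put $\beta_1=y_{n+1}-n$ and $\beta_2=y_{n+2}-n$. For $T\ge 0$ let $\mathbb P_{n+2}(x_1,\dots,x_{n+2};y_1,\dots,y_{n+2};T)$ be the probability that $X_j(T)=y_j$ for all $j=1,\dots,n+2$ and that $X_1(t),\dots,X_{n+2}(t)$ do not intersect for $0\le t\le T$, i.e. $X_i(t)\ne X_j(t)$ for all $i\neq j$ and all $t\in[0,T]$. If $T,\beta_1,\beta_2$ stay bounded as $n\to\infty$, then $$\mathbb P_{n+2}(x_1,\dots,x_{n+2};y_1,\dots,y_{n+2};T)=\frac{e^{-(n+2)T}\left(\frac T2\right)^{\beta_1+\beta_2-3}e^{T^2/4}}{(\beta_1-1)!\,(\beta_2-1)!}\,(\beta_2-\beta_1)\left(1+O\!\left(\frac1{n^2}\right)\right),\qquad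 n\to\infty.$$ Here the error term is uniform: for all bounds $M\geq 0$ and $b\in\mathbb N$ there are $C$ and $n_0$ such that, for all $n\ge n_0$, all $T\in[0,M]$ and all $1\le\beta_1<\beta_2\le b$, the factor in the last parentheses is $1+\varepsilon$ with $|\varepsilon|\le C/n^2$ (and $0^0=1$ when $T=0$). -/

import Mathlib

open MeasureTheory ProbabilityTheory
open scoped NNReal Nat

/-- `N` is a (homogeneous) Poisson process of rate `r` on the probability space `(Ω, μ)`: it starts
at `0`, has independent increments, `N t - N s` is Poisson distributed with parameter `r (t - s)`,
and almost every path is nondecreasing and right-continuous. (As almost every path is nondecreasing,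
the natural-number subtraction `N t ω - N s ω` with `s ≤ t` is almost surely the true difference.) -/
structure IsPoissonProcess {Ω : Type*} [MeasurableSpace Ω] (N : ℝ≥0 → Ω → ℕ) (r : ℝ≥0)
    (μ : Measure Ω) : Prop where
  measurable : ∀ t, Measurable (N t)
  start : ∀ᵐ ω ∂μ, N 0 ω = 0
  indep : HasIndepIncrements N μ
  law : ∀ s t, s ≤ t → HasLaw (fun ω => N t ω - N s ω) (poissonMeasure (r * (t - s))) μ
  mono : ∀ᵐ ω ∂μ, Monotone fun t => N t ω
  rightCont : ∀ᵐ ω ∂μ, ∀ t, ContinuousWithinAt (fun s => N s ω) (Set.Ici t) t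

/-- `X` is a continuous time random walk on `ℤ` that begins at `x`: up to the shift by `x`, it is
the difference of two independent Poisson processes of rate `1/2`. -/
def IsContinuousTimeRandomWalk {Ω : Type*} [MeasurableSpace Ω] (X : ℝ≥0 → Ω → ℤ) (x : ℤ)
    (μ : Measure Ω) : Prop :=
  ∃ N₁ N₂ : ℝ≥0 → Ω → ℕ,
    IsPoissonProcess N₁ (1 / 2) μ ∧ IsPoissonProcess N₂ (1 / 2) μ ∧
    IndepFun (fun ω t => N₁ t ω) (fun ω t => N₂ t ω) μ ∧
    ∀ t ω, X t ω = x + (N₁ t ω : ℤ) - (N₂ t ω : ℤ)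

/-- `X` is a family of independent continuous time random walks, where `X j` begins at `x j`.
The independence is that of the whole processes, seen as random elements of `ℤ ^ [0, ∞)`. -/
structure IsIndepRandomWalks {Ω : Type*} [MeasurableSpace Ω] {m : ℕ} (X : Fin m → ℝ≥0 → Ω → ℤ)
    (x : Fin m → ℤ) (μ : Measure Ω) : Prop where
  walk : ∀ j, IsContinuousTimeRandomWalk (X j) (x j) μ
  indep : iIndepFun (fun j ω t => X j t ω) μ

/-- The probability that `X j` is at `y j` at time `T` for every `j`, and that no two of the walks
are at the same place at the same time during `[0, T]`. -/
noncomputable def nonIntersectionProb {Ω : Type*} [MeasurableSpace Ω] (μ : Measure Ω) {m : ℕ}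
    (X : Fin m → ℝ≥0 → Ω → ℤ) (y : Fin m → ℤ) (T : ℝ≥0) : ℝ :=
  μ.real {ω | (∀ j, X j T ω = y j) ∧
    ∀ t, t ≤ T → ∀ i j, i ≠ j → X i t ω ≠ X j t ω}

/-! Put `N = n + 2`, `v = y - x` and `d = |v|` (the `ℓ¹` norm). The starting points are consecutive
integers, so the walks stay in strict order exactly when their displacement vector stays monotone.
The problem is thus about walks from `0` in the cone of monotone vectors.

Probability: sample the walks on a grid of mesh `T / k`. Up to an error of second order in `T / k`,
each grid step rests or makes one unit step, which cannot carry one walk past another without a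
collision. As `k → ∞`, right-continuity recovers the true event and binomial weights become Poisson
weights, so that the probability is `e^(-NT) ∑ (T/2)^m / m! * W_m(v)` with `W_m` the `walkCount`
(`nonIntersectionProb_eq_tsum`).

Combinatorics: a monotone vector with a zero coordinate is a pair of partitions, its positive and
its negative part; outward and inward steps add and remove boxes. As in the square of Young's
lattice, "out then in" minus "in then out" is multiplication by `2`. Hence the numbers `f` of
shortest walks, summed over the outward neighbours of `v`, give `2 (d + 1) f(v)`
(`outwardSum_eq_of_exists`), and induction yields `W_(d+2r)(v) = (d+2r)! / (d! r!) * f(v)` while `2d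
+ 2r < N` (`walkCount_eq_walkWeight`). If this held for all `r`, the series would be `(T/2)^d / d! *
f(v) * e^(T²/4)`; the hook length formula for two rows of lengths `β₁ - 1` and `β₂ - 2` turns it
into the main term.

Error: for every `r` the same argument still gives `≤` (`walkCount_le_walkWeight`). The relative
error is therefore at most a tail of an exponential series over `r` of order `n`, which is well
below `1 / n²`. -/

/-- The elementary step that moves coordinate `e.1` by `1` (if `e.2`) or by `-1`. -/
def latticeStep {N : ℕ} (e : Fin N × Bool) : Fin N → ℤ :=
  Pi.single e.1 (if e.2 then 1 else -1)

open Classical in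
/-- The number of walks with `m` elementary steps from `0` to `v`, all of whose positions after the
start are monotone vectors. -/
noncomputable def walkCount {N : ℕ} : ℕ → (Fin N → ℤ) → ℝ
  | 0, v => if v = 0 then 1 else 0
  | m + 1, v => if Monotone v then ∑ e, walkCount m (v + latticeStep e) else 0

/-- The `ℓ¹` norm of an integer vector. -/
def latticeNorm {N : ℕ} (v : Fin N → ℤ) : ℕ := ∑ j, (v j).natAbs

/-- The step `e` from `v` decreases the `ℓ¹` norm. -/
def IsInward {N : ℕ} (v : Fin N → ℤ) (e : Fin N × Bool) : Prop :=
  if e.2 then v e.1 < 0 else 0 < v e.1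

/-- The number of shortest walks from `0` to `v` through monotone vectors. -/
noncomputable def geodesicCount {N : ℕ} (v : Fin N → ℤ) : ℝ := walkCount (latticeNorm v) v

/-! ### Steps, norms and walk counts in the cone of monotone vectors -/

section Lattice

variable {N : ℕ} (v : Fin N → ℤ)

lemma latticeStep_apply_self (e : Fin N × Bool) :
    latticeStep e e.1 = if e.2 then 1 else -1 := by
  simp [latticeStep]

lemma latticeStep_apply_of_ne {e : Fin N × Bool} {j : Fin N} (h : j ≠ e.1) :
    latticeStep e j = 0 := by
  simp [latticeStep, h]

lemma latticeStep_flip (j : Fin N) (s : Bool) : latticeStep (j, !s) = -latticeStep (j, s) := by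
  cases s <;> simp [latticeStep, ← Pi.single_neg]

lemma latticeStep_injective : Function.Injective (latticeStep (N := N)) := by
  rintro ⟨i, s⟩ ⟨j, t⟩ h
  have h1 := congrFun h i
  rw [latticeStep_apply_self (i, s)] at h1
  by_cases hij : i = j
  · subst hij
    rw [latticeStep_apply_self (i, t)] at h1
    cases s <;> cases t <;> simp_all
  · rw [latticeStep_apply_of_ne (e := (j, t)) hij] at h1
    cases s <;> simp at h1

lemma latticeStep_ne_zero (e : Fin N × Bool) : latticeStep e ≠ 0 := by
  intro h
  have := congrFun h e.1
  rw [latticeStep_apply_self] at this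
  split_ifs at this <;> simp at this

lemma latticeNorm_add_step (e : Fin N × Bool) :
    latticeNorm (v + latticeStep e) + (v e.1).natAbs
      = latticeNorm v + (v e.1 + if e.2 then 1 else -1).natAbs := by
  unfold latticeNorm
  rw [← Finset.add_sum_erase _ _ (Finset.mem_univ e.1),
    ← Finset.add_sum_erase _ (fun j => (v j).natAbs) (Finset.mem_univ e.1)]
  have : ∑ j ∈ Finset.univ.erase e.1, ((v + latticeStep e) j).natAbs
      = ∑ j ∈ Finset.univ.erase e.1, (v j).natAbs := by
    refine Finset.sum_congr rfl fun j hj => ?_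
    rw [Pi.add_apply, latticeStep_apply_of_ne (Finset.ne_of_mem_erase hj), add_zero]
  rw [this, Pi.add_apply, latticeStep_apply_self]
  ring

variable {v}

lemma IsInward.latticeNorm {e : Fin N × Bool} (h : IsInward v e) :
    latticeNorm (v + latticeStep e) + 1 = latticeNorm v := by
  have := latticeNorm_add_step v e
  unfold IsInward at h
  split_ifs at h this <;> omega

lemma latticeNorm_of_not_isInward {e : Fin N × Bool} (h : ¬ IsInward v e) :
    latticeNorm (v + latticeStep e) = latticeNorm v + 1 := by
  have := latticeNorm_add_step v e
  unfold IsInward at h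
  split_ifs at h this <;> omega

lemma latticeNorm_eq_zero : latticeNorm v = 0 ↔ v = 0 := by
  simp [latticeNorm, funext_iff]

/-- Each nonzero coordinate contributes at least `1` to the norm. This is how a large rank provides
the zero coordinate on which the exact identities depend. -/
lemma exists_eq_zero_of_latticeNorm_lt (h : latticeNorm v < N) : ∃ j, v j = 0 := by
  by_contra! hne
  have : ∑ _j : Fin N, 1 ≤ latticeNorm v :=
    Finset.sum_le_sum fun j _ => Nat.one_le_iff_ne_zero.2 (by simpa using hne j)
  simp at this
  omega

lemma walkCount_nonneg (m : ℕ) (v : Fin N → ℤ) : 0 ≤ walkCount m v := by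
  induction m generalizing v with
  | zero => rw [walkCount]; split_ifs <;> simp
  | succ m ih =>
    rw [walkCount]
    split_ifs
    · exact Finset.sum_nonneg fun e _ => ih _
    · rfl

lemma walkCount_le (m : ℕ) (v : Fin N → ℤ) : walkCount m v ≤ (2 * N) ^ m := by
  induction m generalizing v with
  | zero => rw [walkCount]; split_ifs <;> simp
  | succ m ih =>
    rw [walkCount]
    split_ifs
    · refine (Finset.sum_le_sum fun e _ => ih _).trans (le_of_eq ?_)
      simp
      ring
    · positivity

lemma walkCount_of_not_monotone (m : ℕ) (h : ¬ Monotone v) : walkCount m v = 0 := by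
  cases m with
  | zero => rw [walkCount, if_neg]; rintro rfl; exact h fun _ _ _ => le_rfl
  | succ m => rw [walkCount, if_neg h]

lemma walkCount_succ (m : ℕ) (h : Monotone v) :
    walkCount (m + 1) v = ∑ e, walkCount m (v + latticeStep e) := by
  rw [walkCount, if_pos h]

/-- Walks have at least as many steps as the norm of their endpoint, with the same parity. -/
lemma exists_eq_add_of_walkCount_ne_zero {m : ℕ} (h : walkCount m v ≠ 0) :
    ∃ r, m = latticeNorm v + 2 * r := by
  induction m generalizing v with
  | zero =>
    rw [walkCount] at h
    refine ⟨0, ?_⟩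
    rw [latticeNorm_eq_zero.2 (by by_contra hv; simp [hv] at h)]
  | succ m ih =>
    rw [walkCount] at h
    split_ifs at h
    · obtain ⟨e, -, he⟩ := Finset.exists_ne_zero_of_sum_ne_zero h
      obtain ⟨r, hr⟩ := ih he
      by_cases hi : IsInward v e
      · exact ⟨r, by have := hi.latticeNorm; omega⟩
      · exact ⟨r + 1, by have := latticeNorm_of_not_isInward hi; omega⟩
    · exact absurd rfl h

lemma walkCount_eq_zero_of_lt {m : ℕ} (h : m < latticeNorm v) : walkCount m v = 0 := by
  by_contra hne
  obtain ⟨r, hr⟩ := exists_eq_add_of_walkCount_ne_zero hne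
  omega

lemma geodesicCount_nonneg (v : Fin N → ℤ) : 0 ≤ geodesicCount v := walkCount_nonneg _ _

lemma geodesicCount_of_not_monotone (h : ¬ Monotone v) : geodesicCount v = 0 :=
  walkCount_of_not_monotone _ h

lemma geodesicCount_zero : geodesicCount (0 : Fin N → ℤ) = 1 := by
  rw [geodesicCount, latticeNorm_eq_zero.2 rfl, walkCount, if_pos rfl]

open Classical in
-- Condition on the last step of a shortest walk: an outward neighbour is too far from `0` to be its
-- previous position.
lemma geodesicCount_eq_sum (hv : Monotone v) (h0 : v ≠ 0) :
    geodesicCount v = ∑ e, if IsInward v e then geodesicCount (v + latticeStep e) else 0 := by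
  obtain ⟨d, hd⟩ := Nat.exists_eq_succ_of_ne_zero (mt latticeNorm_eq_zero.1 h0)
  rw [geodesicCount, hd, walkCount_succ _ hv]
  refine Finset.sum_congr rfl fun e _ => ?_
  split_ifs with h
  · rw [geodesicCount]
    congr 1
    have := h.latticeNorm
    omega
  · refine walkCount_eq_zero_of_lt ?_
    rw [latticeNorm_of_not_isInward h]
    omega

end Lattice

/-! ### Commuting outward and inward steps -/

section Exchange

variable {N : ℕ} {v : Fin N → ℤ}

lemma latticeStep_apply (e : Fin N × Bool) (j : Fin N) :
    latticeStep e j = if j = e.1 then (if e.2 then 1 else -1) else 0 := by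
  split_ifs with h
  · subst h; simp [latticeStep_apply_self, *]
  · subst h; simp [latticeStep_apply_self, *]
  · exact latticeStep_apply_of_ne h

lemma isInward_add_step_of_ne {c e : Fin N × Bool} (h : e.1 ≠ c.1) :
    IsInward (v + latticeStep c) e ↔ IsInward v e := by
  simp [IsInward, latticeStep_apply_of_ne h]

/-- The intermediate vector could fail to be monotone only if `c` and `e` moved two equal
coordinates in the same direction. But then both steps would be inward or both outward. The next
lemma rests on the same reason. -/
lemma monotone_add_outward (hv : Monotone v) {c e : Fin N × Bool} (hce : e.1 ≠ c.1)
    (hc : ¬ IsInward v c) (he : IsInward v e)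
    (h : Monotone (v + latticeStep c + latticeStep e)) : Monotone (v + latticeStep c) := by
  obtain ⟨i, s⟩ := c
  obtain ⟨j, t⟩ := e
  intro a b hab
  have h1 := hv hab
  have h2 := h hab
  have h3 : a = b → v a = v b := fun h => h ▸ rfl
  simp only [IsInward, Pi.add_apply, latticeStep_apply] at *
  by_cases ha : a = i <;> by_cases hb : b = i <;> by_cases ha' : a = j <;> by_cases hb' : b = j <;>
    cases s <;> cases t <;> simp_all <;> omega

lemma monotone_add_inward (hv : Monotone v) {c e : Fin N × Bool} (hce : e.1 ≠ c.1)
    (hc : ¬ IsInward v c) (he : IsInward v e)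
    (h : Monotone (v + latticeStep c + latticeStep e)) : Monotone (v + latticeStep e) := by
  obtain ⟨i, s⟩ := c
  obtain ⟨j, t⟩ := e
  intro a b hab
  have h1 := hv hab
  have h2 := h hab
  have h3 : a = b → v a = v b := fun h => h ▸ rfl
  simp only [IsInward, Pi.add_apply, latticeStep_apply] at *
  by_cases ha : a = i <;> by_cases hb : b = i <;> by_cases ha' : a = j <;> by_cases hb' : b = j <;>
    cases s <;> cases t <;> simp_all <;> omega

open Classical in
/-- The contribution of an outward step `c` followed by an inward step `e`. -/
noncomputable def outInTerm (v : Fin N → ℤ) (c e : Fin N × Bool) : ℝ :=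
  if ¬ IsInward v c ∧ Monotone (v + latticeStep c) ∧ IsInward (v + latticeStep c) e then
    geodesicCount (v + latticeStep c + latticeStep e) else 0

open Classical in
/-- The contribution of an inward step `e` followed by an outward step `c`. -/
noncomputable def inOutTerm (v : Fin N → ℤ) (c e : Fin N × Bool) : ℝ :=
  if IsInward v e ∧ Monotone (v + latticeStep e) ∧ ¬ IsInward (v + latticeStep e) c then
    geodesicCount (v + latticeStep e + latticeStep c) else 0

/-- Steps in different coordinates can be interchanged: neither affects whether the other is inward,
and both intermediate vectors are monotone once the endpoints are. -/
lemma outInTerm_eq_inOutTerm (hv : Monotone v) {c e : Fin N × Bool} (hce : e.1 ≠ c.1) :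
    outInTerm v c e = inOutTerm v c e := by
  have hcomm : v + latticeStep e + latticeStep c = v + latticeStep c + latticeStep e := by abel
  rw [outInTerm, inOutTerm, isInward_add_step_of_ne hce, isInward_add_step_of_ne hce.symm, hcomm]
  by_cases hm : Monotone (v + latticeStep c + latticeStep e)
  · by_cases hc : IsInward v c
    · simp [hc]
    by_cases he : IsInward v e
    · rw [if_pos ⟨hc, monotone_add_outward hv hce hc he hm, he⟩,
        if_pos ⟨he, monotone_add_inward hv hce hc he hm, hc⟩]
    · simp [he]
  · simp [geodesicCount_of_not_monotone hm]

open Classical in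
/-- The sum of the geodesic counts over the outward neighbours. -/
noncomputable def outwardSum (v : Fin N → ℤ) : ℝ :=
  ∑ e, if IsInward v e then 0 else geodesicCount (v + latticeStep e)

open Classical in
lemma outwardSum_eq (v : Fin N → ℤ) : outwardSum v = ∑ c, ∑ e, outInTerm v c e := by
  refine Finset.sum_congr rfl fun c _ => ?_
  by_cases hc : IsInward v c
  · simp [hc, outInTerm]
  by_cases hm : Monotone (v + latticeStep c)
  · rw [if_neg hc, geodesicCount_eq_sum hm]
    · simp [outInTerm, hc, hm]
    · rw [ne_eq, ← latticeNorm_eq_zero, latticeNorm_of_not_isInward hc]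
      omega
  · simp [outInTerm, hc, hm, geodesicCount_of_not_monotone hm]

open Classical in
lemma sum_inward_outwardSum (v : Fin N → ℤ) :
    ∑ e, (if IsInward v e ∧ Monotone (v + latticeStep e) then outwardSum (v + latticeStep e) else 0)
      = ∑ c, ∑ e, inOutTerm v c e := by
  rw [Finset.sum_comm]
  refine Finset.sum_congr rfl fun e _ => ?_
  split_ifs with h
  · refine Finset.sum_congr rfl fun c _ => ?_
    simp only [inOutTerm, h, true_and, ite_not]
  · refine (Finset.sum_eq_zero fun c _ => ?_).symm
    rw [inOutTerm, if_neg (fun h' => h ⟨h'.1, h'.2.1⟩)]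

lemma add_step_add_flip (v : Fin N → ℤ) (j : Fin N) (s : Bool) :
    v + latticeStep (j, s) + latticeStep (j, !s) = v := by
  rw [latticeStep_flip]; abel

lemma isInward_flip_iff (v : Fin N → ℤ) (j : Fin N) (s : Bool) :
    IsInward (v + latticeStep (j, s)) (j, !s) ↔ ¬ IsInward v (j, s) := by
  cases s <;> simp [IsInward, latticeStep_apply] <;> omega

lemma isInward_add_step_self (j : Fin N) (s : Bool) (h : ¬ IsInward v (j, s)) :
    ¬ IsInward (v + latticeStep (j, s)) (j, s) := by
  cases s <;> simp [IsInward, latticeStep_apply] at * <;> omega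

open Classical in
lemma sum_outInTerm_row (v : Fin N → ℤ) (j : Fin N) (s : Bool) :
    ∑ t, outInTerm v (j, s) (j, t)
      = if ¬ IsInward v (j, s) ∧ Monotone (v + latticeStep (j, s)) then geodesicCount v else 0 := by
  have h1 : outInTerm v (j, s) (j, s) = 0 := by
    rw [outInTerm, if_neg]
    rintro ⟨h, -, h'⟩
    exact isInward_add_step_self j s h h'
  have h2 : outInTerm v (j, s) (j, !s)
      = if ¬ IsInward v (j, s) ∧ Monotone (v + latticeStep (j, s)) then geodesicCount v else 0 := by
    simp only [outInTerm, isInward_flip_iff, add_step_add_flip]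
    exact if_congr (by tauto) rfl rfl
  cases s <;> simp_all

lemma inOutTerm_nonneg (v : Fin N → ℤ) (c e : Fin N × Bool) : 0 ≤ inOutTerm v c e := by
  rw [inOutTerm]
  split_ifs
  · exact geodesicCount_nonneg _
  · rfl

open Classical in
lemma inOutTerm_flip (v : Fin N → ℤ) (j : Fin N) (t : Bool) :
    inOutTerm v (j, !t) (j, t)
      = if IsInward v (j, t) ∧ Monotone (v + latticeStep (j, t)) then geodesicCount v else 0 := by
  simp only [inOutTerm, isInward_flip_iff, add_step_add_flip]
  exact if_congr (by tauto) rfl rfl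

/-- A repeated step that is first inward and then outward takes a coordinate from `±1` through `0`
to `∓1`, that is, to the wrong side of the coordinate that is `0`. -/
lemma inOutTerm_self (hv : Monotone v) (h0 : ∃ i, v i = 0) (e : Fin N × Bool) : inOutTerm v e e = 0 := by
  obtain ⟨i, hi⟩ := h0
  rw [inOutTerm]
  split_ifs with h
  · refine geodesicCount_of_not_monotone fun hm => ?_
    obtain ⟨he, -, he'⟩ := h
    obtain ⟨j, t⟩ := e
    by_cases hij : i = j
    · subst hij
      cases t <;> simp_all [IsInward]
    · rcases le_total i j with h | h <;> have h1 := hm h <;> have h2 := hv h <;>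
        simp only [IsInward, Pi.add_apply, latticeStep_apply] at he he' h1 <;>
        cases t <;> simp [hij] at he he' h1 <;> omega
  · rfl

open Classical in
lemma le_sum_inOutTerm_row (v : Fin N → ℤ) (j : Fin N) (t : Bool) :
    (if IsInward v (j, t) ∧ Monotone (v + latticeStep (j, t)) then geodesicCount v else 0)
      ≤ ∑ s, inOutTerm v (j, s) (j, t) := by
  rw [← inOutTerm_flip]
  exact Finset.single_le_sum (f := fun s => inOutTerm v (j, s) (j, t))
    (fun s _ => inOutTerm_nonneg _ _ _) (Finset.mem_univ (!t))

open Classical in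
lemma sum_inOutTerm_row (hv : Monotone v) (h0 : ∃ i, v i = 0) (j : Fin N) (t : Bool) :
    ∑ s, inOutTerm v (j, s) (j, t)
      = if IsInward v (j, t) ∧ Monotone (v + latticeStep (j, t)) then geodesicCount v else 0 := by
  rw [← inOutTerm_flip]
  have := inOutTerm_self hv h0 (j, t)
  cases t <;> simp_all

open Classical in
/-- The signed number of neighbours: outward ones count `1`, inward ones `-1`. -/
noncomputable def neighbourBalance (v : Fin N → ℤ) : ℝ :=
  ∑ e, if Monotone (v + latticeStep e) then (if IsInward v e then -1 else 1) else 0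

/-- Off the diagonal the two kinds of terms cancel, so only pairs of steps in a single coordinate
survive. -/
lemma sum_outInTerm_sub_inOutTerm (hv : Monotone v) :
    ∑ c, ∑ e, outInTerm v c e - ∑ c, ∑ e, inOutTerm v c e
      = ∑ j, (∑ s, ∑ t, outInTerm v (j, s) (j, t) - ∑ s, ∑ t, inOutTerm v (j, s) (j, t)) := by
  simp only [Fintype.sum_prod_type]
  rw [← Finset.sum_sub_distrib]
  refine Finset.sum_congr rfl fun i _ => ?_
  rw [Finset.sum_comm (s := Finset.univ (α := Bool)), Finset.sum_comm (s := Finset.univ (α := Bool)),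
    ← Finset.sum_sub_distrib]
  rw [Finset.sum_eq_single i]
  · intro j _ hj
    rw [sub_eq_zero]
    exact Finset.sum_congr rfl fun s _ => Finset.sum_congr rfl fun t _ =>
      outInTerm_eq_inOutTerm hv hj
  · simp

open Classical in
lemma neighbourBalance_mul (v : Fin N → ℤ) : neighbourBalance v * geodesicCount v
    = ∑ j, (∑ s, (if ¬ IsInward v (j, s) ∧ Monotone (v + latticeStep (j, s))
          then geodesicCount v else 0)
        - ∑ s, (if IsInward v (j, s) ∧ Monotone (v + latticeStep (j, s))
          then geodesicCount v else 0)) := by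
  rw [neighbourBalance, Fintype.sum_prod_type, Finset.sum_mul]
  refine Finset.sum_congr rfl fun j _ => ?_
  rw [← Finset.sum_sub_distrib, Finset.sum_mul]
  refine Finset.sum_congr rfl fun s _ => ?_
  by_cases h1 : IsInward v (j, s) <;> by_cases h2 : Monotone (v + latticeStep (j, s)) <;>
    simp [h1, h2]

/-- The diagonal pairs that return to `v` are counted by its neighbours. Without a zero coordinate,
steps across `0` may enlarge the subtracted sum, so only an inequality remains. -/
lemma sum_outInTerm_sub_inOutTerm_le (hv : Monotone v) :
    ∑ c, ∑ e, outInTerm v c e - ∑ c, ∑ e, inOutTerm v c e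
      ≤ neighbourBalance v * geodesicCount v := by
  rw [sum_outInTerm_sub_inOutTerm hv, neighbourBalance_mul]
  refine Finset.sum_le_sum fun j _ => sub_le_sub (le_of_eq ?_) ?_
  · exact Finset.sum_congr rfl fun s _ => sum_outInTerm_row v j s
  · rw [Finset.sum_comm]
    exact Finset.sum_le_sum fun t _ => le_sum_inOutTerm_row v j t

lemma sum_outInTerm_sub_inOutTerm_eq (hv : Monotone v) (h0 : ∃ i, v i = 0) :
    ∑ c, ∑ e, outInTerm v c e - ∑ c, ∑ e, inOutTerm v c e
      = neighbourBalance v * geodesicCount v := by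
  rw [sum_outInTerm_sub_inOutTerm hv, neighbourBalance_mul]
  refine Finset.sum_congr rfl fun j _ => congrArg₂ _ ?_ ?_
  · exact Finset.sum_congr rfl fun s _ => sum_outInTerm_row v j s
  · rw [Finset.sum_comm]
    exact Finset.sum_congr rfl fun t _ => sum_inOutTerm_row hv h0 j t

end Exchange

/-! ### Outward minus inward neighbours -/

section Balance

variable {n : ℕ} {v : Fin (n + 1) → ℤ}

lemma monotone_add_step_castSucc (hv : Monotone v) (j : Fin n) :
    Monotone (v + latticeStep (j.castSucc, true)) ↔ v j.castSucc < v j.succ := by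
  refine ⟨fun h => ?_, fun h => ?_⟩
  · have := h (Fin.castSucc_le_succ j)
    simp [latticeStep_apply, Fin.ext_iff] at this
    omega
  · refine Fin.monotone_iff_le_succ.2 fun i => ?_
    have := Fin.monotone_iff_le_succ.1 hv i
    simp only [Pi.add_apply, latticeStep_apply, if_true]
    by_cases hi : i = j
    · subst hi
      simp [Fin.ext_iff]
      omega
    · rw [if_neg (by simpa using hi)]
      split_ifs <;> omega

lemma monotone_add_step_succ (hv : Monotone v) (j : Fin n) :
    Monotone (v + latticeStep (j.succ, false)) ↔ v j.castSucc < v j.succ := by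
  refine ⟨fun h => ?_, fun h => ?_⟩
  · have := h (Fin.castSucc_le_succ j)
    simp [latticeStep_apply, Fin.ext_iff] at this
    omega
  · refine Fin.monotone_iff_le_succ.2 fun i => ?_
    have := Fin.monotone_iff_le_succ.1 hv i
    simp only [Pi.add_apply, latticeStep_apply, Bool.false_eq_true, if_false]
    by_cases hi : i = j
    · subst hi
      simp [Fin.ext_iff]
      omega
    · rw [if_neg (c := i.succ = j.succ) (by simpa using hi)]
      split_ifs <;> omega

lemma monotone_add_step_last (hv : Monotone v) : Monotone (v + latticeStep (Fin.last n, true)) := by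
  refine Fin.monotone_iff_le_succ.2 fun i => ?_
  have := Fin.monotone_iff_le_succ.1 hv i
  simp only [Pi.add_apply, latticeStep_apply, if_true]
  rw [if_neg (c := i.castSucc = _) (Fin.castSucc_lt_last i).ne]
  split_ifs <;> omega

lemma monotone_add_step_zero (hv : Monotone v) : Monotone (v + latticeStep (0, false)) := by
  refine Fin.monotone_iff_le_succ.2 fun i => ?_
  have := Fin.monotone_iff_le_succ.1 hv i
  simp only [Pi.add_apply, latticeStep_apply, Bool.false_eq_true, if_false]
  rw [if_neg (c := i.succ = _) (Fin.succ_ne_zero i)]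
  split_ifs <;> omega

open Classical in
-- Raising the last coordinate and lowering the first are always allowed. Each gap between
-- consecutive coordinates allows raising the lower one and lowering the upper one; these cancel
-- unless the gap straddles `0` strictly, when both are inward.
lemma neighbourBalance_eq (hv : Monotone v) : neighbourBalance v
    = (if v (Fin.last n) < 0 then -1 else 1) + (if 0 < v 0 then -1 else 1)
      + ∑ j : Fin n, if v j.castSucc < 0 ∧ 0 < v j.succ then -2 else 0 := by
  simp only [neighbourBalance, Fintype.sum_prod_type, Fintype.sum_bool, Finset.sum_add_distrib]
  rw [Fin.sum_univ_castSucc, Fin.sum_univ_succ (n := n) (f := fun j =>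
    if Monotone (v + latticeStep (j, false)) then (if IsInward v (j, false) then (-1 : ℝ) else 1)
    else 0)]
  rw [if_pos (monotone_add_step_last hv), if_pos (monotone_add_step_zero hv)]
  have : ∀ j : Fin n, (if v j.castSucc < 0 ∧ 0 < v j.succ then (-2 : ℝ) else 0)
      = (if Monotone (v + latticeStep (j.castSucc, true)) then
          (if IsInward v (j.castSucc, true) then (-1 : ℝ) else 1) else 0)
        + (if Monotone (v + latticeStep (j.succ, false)) then
          (if IsInward v (j.succ, false) then (-1 : ℝ) else 1) else 0) := by
    intro j
    simp only [monotone_add_step_castSucc hv, monotone_add_step_succ hv, IsInward, if_true,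
      Bool.false_eq_true, if_false]
    by_cases h1 : v j.castSucc < 0 <;> by_cases h2 : 0 < v j.succ <;>
      by_cases h3 : v j.castSucc < v j.succ <;> simp [h1, h2, h3] <;> first | (exfalso; omega) | norm_num
  simp only [this, Finset.sum_add_distrib, IsInward, if_true, Bool.false_eq_true, if_false]
  ring

lemma neighbourBalance_le (hv : Monotone v) : neighbourBalance v ≤ 2 := by
  rw [neighbourBalance_eq hv]
  have h : (∑ j : Fin n, if v j.castSucc < 0 ∧ 0 < v j.succ then (-2 : ℝ) else 0) ≤ 0 :=
    Finset.sum_nonpos fun j _ => by split_ifs <;> norm_num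
  have h1 : (if v (Fin.last n) < 0 then (-1 : ℝ) else 1) ≤ 1 := by split_ifs <;> norm_num
  have h2 : (if 0 < v 0 then (-1 : ℝ) else 1) ≤ 1 := by split_ifs <;> norm_num
  linarith

lemma neighbourBalance_eq_two (hv : Monotone v) (h0 : ∃ i, v i = 0) : neighbourBalance v = 2 := by
  obtain ⟨i, hi⟩ := h0
  have hl := hv (Fin.le_last i)
  have hz := hv (Fin.zero_le i)
  rw [neighbourBalance_eq hv, if_neg (by omega), if_neg (by omega), Finset.sum_eq_zero]
  · norm_num
  · intro j _
    rw [if_neg]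
    rintro ⟨h1, h2⟩
    rcases le_or_gt i j.castSucc with h | h
    · have := hv h
      omega
    · have := hv (Fin.castSucc_lt_iff_succ_le.1 h)
      omega

end Balance

/-! ### Exact and upper bounds for walk counts -/

section Count

variable {n : ℕ}

open Classical in
lemma sum_inward_geodesicCount {v : Fin (n + 1) → ℤ} (hv : Monotone v) (k : ℝ) :
    ∑ e, (if IsInward v e ∧ Monotone (v + latticeStep e) then
        2 * k * geodesicCount (v + latticeStep e) else 0)
      = if v = 0 then 0 else 2 * k * geodesicCount v := by
  split_ifs with h0
  · refine Finset.sum_eq_zero fun e _ => if_neg ?_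
    rintro ⟨h, -⟩
    have := h.latticeNorm
    rw [latticeNorm_eq_zero.2 h0] at this
    omega
  · rw [geodesicCount_eq_sum hv h0, Finset.mul_sum]
    refine Finset.sum_congr rfl fun e _ => ?_
    by_cases h1 : IsInward v e <;> by_cases h2 : Monotone (v + latticeStep e) <;>
      simp [h1, h2, geodesicCount_of_not_monotone]

lemma outwardSum_eq_sub_add (v : Fin (n + 1) → ℤ) : outwardSum v =
    (∑ c, ∑ e, outInTerm v c e - ∑ c, ∑ e, inOutTerm v c e) + ∑ c, ∑ e, inOutTerm v c e := by
  rw [outwardSum_eq]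
  ring

/-- Induction on the norm: exchanging the steps reduces to outward sums at inward neighbours, of
norm one less, which contribute `2 * d * geodesicCount v`; the balance adds at most `2 *
geodesicCount v`. -/
lemma outwardSum_le {v : Fin (n + 1) → ℤ} (hv : Monotone v) :
    outwardSum v ≤ 2 * (latticeNorm v + 1) * geodesicCount v := by
  classical
  induction hd : latticeNorm v using Nat.strong_induction_on generalizing v with
  | _ d ih =>
  have h1 : ∑ c, ∑ e, inOutTerm v c e ≤ 2 * d * geodesicCount v := by
    rw [← sum_inward_outwardSum]
    calc _ ≤ _ := Finset.sum_le_sum (g := fun e =>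
          if IsInward v e ∧ Monotone (v + latticeStep e) then
            2 * d * geodesicCount (v + latticeStep e) else 0) fun e _ => by
          split_ifs with h
          · have hn := h.1.latticeNorm
            have := ih (latticeNorm (v + latticeStep e)) (by omega) h.2 rfl
            rw [← hd, ← hn]
            exact_mod_cast this
          · rfl
      _ ≤ _ := by
        rw [sum_inward_geodesicCount hv]
        split_ifs with h
        · have := geodesicCount_nonneg v
          positivity
        · rfl
  have h2 := sum_outInTerm_sub_inOutTerm_le hv
  have h3 := mul_le_mul_of_nonneg_right (neighbourBalance_le hv) (geodesicCount_nonneg v)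
  rw [outwardSum_eq_sub_add]
  linarith

lemma outwardSum_eq_of_exists {v : Fin (n + 1) → ℤ} (hv : Monotone v) (h0 : ∃ i, v i = 0) :
    outwardSum v = 2 * (latticeNorm v + 1) * geodesicCount v := by
  classical
  induction hd : latticeNorm v using Nat.strong_induction_on generalizing v with
  | _ d ih =>
  have h1 : ∑ c, ∑ e, inOutTerm v c e = 2 * d * geodesicCount v := by
    rw [← sum_inward_outwardSum]
    calc _ = _ := Finset.sum_congr (g := fun e =>
          if IsInward v e ∧ Monotone (v + latticeStep e) then
            2 * d * geodesicCount (v + latticeStep e) else 0) rfl fun e _ => by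
          split_ifs with h
          · have hn := h.1.latticeNorm
            -- An inward step moves a nonzero coordinate, so the zero coordinate is inherited.
            obtain ⟨i, hi⟩ := h0
            have := ih (latticeNorm (v + latticeStep e)) (by omega) h.2 ⟨i, ?_⟩ rfl
            · rw [← hd, ← hn]
              exact_mod_cast this
            · rw [Pi.add_apply, latticeStep_apply_of_ne, hi, add_zero]
              rintro rfl
              have := h.1
              simp [IsInward, hi] at this
          · rfl
      _ = _ := by
        rw [sum_inward_geodesicCount hv]
        split_ifs with h
        · rw [← hd, latticeNorm_eq_zero.2 h]
          simp
        · rfl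
  rw [outwardSum_eq_sub_add, sum_outInTerm_sub_inOutTerm_eq hv h0, neighbourBalance_eq_two hv h0, h1]
  ring

/-- In the stable range, the number of walks with `d + 2 * r` steps to a vector of norm `d` is this
multiple of the number of shortest walks. -/
noncomputable def walkWeight (d r : ℕ) : ℝ := (d + 2 * r)! / (d ! * r !)

lemma walkWeight_nonneg (d r : ℕ) : 0 ≤ walkWeight d r := by
  unfold walkWeight; positivity

lemma walkWeight_pos (d r : ℕ) : 0 < walkWeight d r := by
  unfold walkWeight; positivity

open Classical in
/-- The neighbour sum of the counts, split into inward and outward neighbours. -/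
lemma sum_walkCount_split (m : ℕ) (v : Fin (n + 1) → ℤ) :
    ∑ e, walkCount m (v + latticeStep e)
      = ∑ e, (if IsInward v e then walkCount m (v + latticeStep e) else 0)
        + ∑ e, (if IsInward v e then 0 else walkCount m (v + latticeStep e)) := by
  rw [← Finset.sum_add_distrib]
  exact Finset.sum_congr rfl fun e _ => by split_ifs <;> simp

lemma walkWeight_zero_right (d : ℕ) : walkWeight d 0 = 1 := by
  unfold walkWeight
  simp [Nat.factorial_ne_zero]

lemma walkWeight_zero_succ (r : ℕ) : walkWeight 1 r * 2 = walkWeight 0 (r + 1) := by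
  unfold walkWeight
  rw [show 0 + 2 * (r + 1) = (1 + 2 * r) + 1 by ring]
  simp only [Nat.factorial_succ, Nat.factorial_zero]
  push_cast
  field_simp
  ring

lemma walkWeight_succ_succ (d r : ℕ) :
    walkWeight d (r + 1) + walkWeight (d + 2) r * (2 * (d + 1 + 1)) = walkWeight (d + 1) (r + 1) := by
  unfold walkWeight
  rw [show d + 2 * (r + 1) = d + 2 * r + 2 by ring, show d + 2 + 2 * r = d + 2 * r + 2 by ring,
    show d + 1 + 2 * (r + 1) = (d + 2 * r + 2) + 1 by ring]
  simp only [Nat.factorial_succ]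
  push_cast
  field_simp
  ring

/-- One step of the walk recursion at norm `d`: inward neighbours keep `r + 1` and have norm `d -
1`, outward ones have `r` and norm `d + 1`. At `d = 0` there is no inward neighbour. -/
lemma walkWeight_le_step (d r : ℕ) {S K : ℝ} (hS : S ≤ 2 * (d + 1) * K) :
    (if d = 0 then 0 else walkWeight (d - 1) (r + 1) * K) + walkWeight (d + 1) r * S
      ≤ walkWeight d (r + 1) * K := by
  have h := mul_le_mul_of_nonneg_left hS (walkWeight_nonneg (d + 1) r)
  refine (add_le_add_right h _).trans (le_of_eq ?_)
  cases d with
  | zero => rw [if_pos rfl, ← walkWeight_zero_succ]; push_cast; ring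
  | succ d => rw [if_neg (by omega), ← walkWeight_succ_succ]; push_cast; ring_nf

lemma walkWeight_eq_step (d r : ℕ) {S K : ℝ} (hS : S = 2 * (d + 1) * K) :
    (if d = 0 then 0 else walkWeight (d - 1) (r + 1) * K) + walkWeight (d + 1) r * S
      = walkWeight d (r + 1) * K := by
  subst hS
  cases d with
  | zero => rw [if_pos rfl, ← walkWeight_zero_succ]; push_cast; ring
  | succ d => rw [if_neg (by omega), ← walkWeight_succ_succ]; push_cast; ring_nf

lemma walkCount_latticeNorm (v : Fin (n + 1) → ℤ) :
    walkCount (latticeNorm v) v = walkWeight (latticeNorm v) 0 * geodesicCount v := by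
  rw [walkWeight_zero_right, one_mul, geodesicCount]

open Classical in
lemma sum_inward_const_mul {v : Fin (n + 1) → ℤ} (hv : Monotone v) (k : ℝ) :
    ∑ e, (if IsInward v e then k * geodesicCount (v + latticeStep e) else 0)
      = if latticeNorm v = 0 then 0 else k * geodesicCount v := by
  split_ifs with h0
  · refine Finset.sum_eq_zero fun e _ => if_neg fun h => ?_
    have := h.latticeNorm
    omega
  · rw [geodesicCount_eq_sum hv (mt latticeNorm_eq_zero.2 h0), Finset.mul_sum]
    exact Finset.sum_congr rfl fun e _ => by split_ifs <;> simp

open Classical in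
lemma sum_outward_const_mul (v : Fin (n + 1) → ℤ) (k : ℝ) :
    ∑ e, (if IsInward v e then 0 else k * geodesicCount (v + latticeStep e))
      = k * outwardSum v := by
  rw [outwardSum, Finset.mul_sum]
  exact Finset.sum_congr rfl fun e _ => by split_ifs <;> simp

/-- An upper bound for the number of walks, which holds in every rank. -/
lemma walkCount_le_walkWeight (r : ℕ) (v : Fin (n + 1) → ℤ) :
    walkCount (latticeNorm v + 2 * r) v ≤ walkWeight (latticeNorm v) r * geodesicCount v := by
  classical
  induction hm : latticeNorm v + 2 * r generalizing v r with
  | zero =>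
    obtain rfl : r = 0 := by omega
    rw [← walkCount_latticeNorm, show latticeNorm v = 0 by omega]
  | succ m ih =>
  by_cases hv : Monotone v
  swap
  · rw [walkCount_of_not_monotone _ hv, geodesicCount_of_not_monotone hv, mul_zero]
  cases r with
  | zero => rw [← walkCount_latticeNorm, ← hm]; rfl
  | succ r =>
  rw [walkCount_succ _ hv, sum_walkCount_split]
  refine le_trans (add_le_add ?_ ?_) (walkWeight_le_step (latticeNorm v) r (outwardSum_le hv))
  · rw [← sum_inward_const_mul hv]
    refine Finset.sum_le_sum fun e _ => ?_
    split_ifs with h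
    · have := h.latticeNorm
      rw [← this, Nat.add_sub_cancel]
      exact ih (r + 1) _ (by omega)
    · rfl
  · rw [← sum_outward_const_mul]
    refine Finset.sum_le_sum fun e _ => ?_
    split_ifs with h
    · rfl
    · have := latticeNorm_of_not_isInward h
      rw [← this]
      exact ih r _ (by omega)

/-- The number of walks in the stable range. -/
lemma walkCount_eq_walkWeight (r : ℕ) (v : Fin (n + 1) → ℤ)
    (hr : latticeNorm v + 2 * r + latticeNorm v < n + 1) :
    walkCount (latticeNorm v + 2 * r) v = walkWeight (latticeNorm v) r * geodesicCount v := by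
  classical
  induction hm : latticeNorm v + 2 * r generalizing v r with
  | zero =>
    obtain rfl : r = 0 := by omega
    rw [← walkCount_latticeNorm, show latticeNorm v = 0 by omega]
  | succ m ih =>
  by_cases hv : Monotone v
  swap
  · rw [walkCount_of_not_monotone _ hv, geodesicCount_of_not_monotone hv, mul_zero]
  cases r with
  | zero => rw [← walkCount_latticeNorm, ← hm]; rfl
  | succ r =>
  -- The stable range forces `latticeNorm v < n + 1`. Number of steps plus norm never increases in
  -- the recursion, so the neighbours stay in this range.
  have h0 := exists_eq_zero_of_latticeNorm_lt (v := v) (by omega)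
  rw [walkCount_succ _ hv, sum_walkCount_split,
    ← walkWeight_eq_step (latticeNorm v) r (outwardSum_eq_of_exists hv h0)]
  congr 1
  · rw [← sum_inward_const_mul hv]
    refine Finset.sum_congr rfl fun e _ => ?_
    split_ifs with h
    · have := h.latticeNorm
      rw [← this, Nat.add_sub_cancel]
      exact ih (r + 1) _ (by omega) (by omega)
    · rfl
  · rw [← sum_outward_const_mul]
    refine Finset.sum_congr rfl fun e _ => ?_
    split_ifs with h
    · rfl
    · have := latticeNorm_of_not_isInward h
      rw [← this]
      exact ih r _ (by omega) (by omega)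

end Count

/-! ### Shortest walks to two-row shapes -/

section TwoRow

variable {n : ℕ}

/-- The vector whose last two coordinates are `p` and `q`, and whose other coordinates are `0`. -/
def twoRow (n p q : ℕ) : Fin (n + 2) → ℤ :=
  fun j => if (j : ℕ) < n then 0 else if (j : ℕ) = n then p else q

lemma latticeNorm_twoRow (n p q : ℕ) : latticeNorm (twoRow n p q) = p + q := by
  rw [latticeNorm, Fin.sum_univ_castSucc, Fin.sum_univ_castSucc]
  simp [twoRow]

lemma monotone_twoRow {p q : ℕ} (h : p ≤ q) : Monotone (twoRow n p q) := by
  intro i j hij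
  have : (i : ℕ) ≤ j := hij
  simp only [twoRow]
  split_ifs <;> omega

lemma not_monotone_twoRow {p q : ℕ} (h : q < p) : ¬ Monotone (twoRow n p q) := by
  intro hm
  have := hm (Fin.castSucc_lt_last (Fin.last n)).le
  simp [twoRow] at this
  omega

lemma twoRow_add_step_last (p q : ℕ) :
    twoRow n p (q + 1) + latticeStep (Fin.last (n + 1), false) = twoRow n p q := by
  ext j
  simp only [twoRow, Pi.add_apply, latticeStep_apply, Fin.ext_iff, Fin.val_last]
  split_ifs <;> first | omega | simp_all

lemma twoRow_add_step_castSucc (p q : ℕ) :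
    twoRow n (p + 1) q + latticeStep ((Fin.last n).castSucc, false) = twoRow n p q := by
  ext j
  simp only [twoRow, Pi.add_apply, latticeStep_apply, Fin.ext_iff, Fin.val_last, Fin.val_castSucc]
  split_ifs <;> first | omega | simp_all

lemma geodesicCount_twoRow_eq {p q : ℕ} (h : p ≤ q) (h0 : 0 < q) :
    geodesicCount (twoRow n p q)
      = (if p = 0 then 0 else geodesicCount (twoRow n (p - 1) q))
        + geodesicCount (twoRow n p (q - 1)) := by
  classical
  rw [geodesicCount_eq_sum (monotone_twoRow h)
    (by rw [ne_eq, ← latticeNorm_eq_zero, latticeNorm_twoRow]; omega)]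
  rw [Fintype.sum_prod_type, Fin.sum_univ_castSucc, Fin.sum_univ_castSucc]
  obtain ⟨q, rfl⟩ := Nat.exists_eq_succ_of_ne_zero h0.ne'
  have hlast : ∑ s, (if IsInward (twoRow n p (q + 1)) (Fin.last (n + 1), s) then
      geodesicCount (twoRow n p (q + 1) + latticeStep (Fin.last (n + 1), s)) else 0)
      = geodesicCount (twoRow n p q) := by
    rw [Fintype.sum_bool, twoRow_add_step_last, if_neg, if_pos, zero_add] <;>
      simp [IsInward, twoRow]
    omega
  have hprev : ∑ s, (if IsInward (twoRow n p (q + 1)) ((Fin.last n).castSucc, s) then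
      geodesicCount (twoRow n p (q + 1) + latticeStep ((Fin.last n).castSucc, s)) else 0)
      = if p = 0 then 0 else geodesicCount (twoRow n (p - 1) (q + 1)) := by
    cases p with
    | zero => simp [IsInward, twoRow]
    | succ p =>
      rw [Fintype.sum_bool, twoRow_add_step_castSucc, if_neg, if_pos, zero_add] <;>
        simp [IsInward, twoRow]
      omega
  rw [hlast, hprev, Finset.sum_eq_zero]
  · simp
  · intro i _
    simp [IsInward, twoRow]

/-- The hook length formula for shapes with two rows. -/
lemma geodesicCount_twoRow (n : ℕ) {p q : ℕ} (h : p ≤ q + 1) :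
    geodesicCount (twoRow n p q) = (p + q)! * (q + 1 - p) / (p ! * (q + 1)!) := by
  induction hs : p + q generalizing p q with
  | zero =>
    obtain rfl : p = 0 := by omega
    obtain rfl : q = 0 := by omega
    have : twoRow n 0 0 = 0 := by ext j; simp [twoRow]
    rw [this, geodesicCount_zero]
    simp
  | succ s ih =>
    -- The boundary case `p = q + 1` is not monotone and the formula vanishes there; including it
    -- lets the recursion close when `p = q`.
    rcases h.eq_or_lt with rfl | h
    · rw [geodesicCount_of_not_monotone (not_monotone_twoRow (by omega))]
      simp
    cases q with
    | zero => omega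
    | succ q =>
      rw [geodesicCount_twoRow_eq (by omega) (by omega), Nat.add_sub_cancel,
        ih (p := p) (q := q) (by omega) (by omega)]
      cases p with
      | zero =>
        obtain rfl : q = s := by omega
        simp only [Nat.factorial_succ]
        push_cast
        simp
        field_simp
      | succ p =>
        obtain rfl : s = p + 1 + q := by omega
        rw [if_neg (by omega), Nat.add_sub_cancel, ih (p := p) (q := q + 1) (by omega) (by omega)]
        simp only [Nat.factorial_succ]
        push_cast
        field_simp
        ring

lemma geodesicCount_twoRow_pos (n : ℕ) {p q : ℕ} (h : p ≤ q) : 0 < geodesicCount (twoRow n p q) := by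
  rw [geodesicCount_twoRow n (by omega)]
  have : (p : ℝ) ≤ q := by exact_mod_cast h
  have : (0 : ℝ) < q + 1 - p := by linarith
  positivity

end TwoRow

/-! ### Summing the generating function and bounding its error -/

section Series

variable {n : ℕ}

lemma summable_walkCount (c : ℝ) (v : Fin (n + 1) → ℤ) :
    Summable fun m => c ^ m / m ! * walkCount m v := by
  refine Summable.of_norm_bounded
    (g := fun m => (|c| * (2 * (n + 1 : ℕ))) ^ m / m !)
    (Real.summable_pow_div_factorial _) fun m => ?_
  rw [norm_mul, norm_div, norm_pow, Real.norm_eq_abs, Real.norm_natCast, Real.norm_eq_abs,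
    abs_of_nonneg (walkCount_nonneg _ _), mul_pow, mul_div_right_comm]
  gcongr
  exact walkCount_le m v

/-- The exponential generating function of the walk counts runs over the relevant parity only. -/
lemma tsum_walkCount_eq (c : ℝ) (v : Fin (n + 1) → ℤ) :
    ∑' m, c ^ m / m ! * walkCount m v
      = ∑' r, c ^ (latticeNorm v + 2 * r) / (latticeNorm v + 2 * r)!
          * walkCount (latticeNorm v + 2 * r) v := by
  refine (Function.Injective.tsum_eq (g := fun r => latticeNorm v + 2 * r)
    (fun a b h => by simpa using h) fun m hm => ?_).symm
  rw [Function.mem_support] at hm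
  obtain ⟨r, hr⟩ := exists_eq_add_of_walkCount_ne_zero (right_ne_zero_of_mul hm)
  exact ⟨r, hr.symm⟩

/-- The ratio of the number of walks and its value in the stable range. -/
noncomputable def walkRatio (v : Fin (n + 1) → ℤ) (r : ℕ) : ℝ :=
  walkCount (latticeNorm v + 2 * r) v / (walkWeight (latticeNorm v) r * geodesicCount v)

variable {v : Fin (n + 1) → ℤ}

lemma walkRatio_nonneg (r : ℕ) : 0 ≤ walkRatio v r :=
  div_nonneg (walkCount_nonneg _ _) (mul_nonneg (walkWeight_nonneg _ _) (geodesicCount_nonneg _))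

lemma walkRatio_le_one (r : ℕ) : walkRatio v r ≤ 1 :=
  div_le_one_of_le₀ (walkCount_le_walkWeight r v)
    (mul_nonneg (walkWeight_nonneg _ _) (geodesicCount_nonneg _))

lemma walkRatio_eq_one (hK : 0 < geodesicCount v) {r : ℕ}
    (hr : latticeNorm v + 2 * r + latticeNorm v < n + 1) : walkRatio v r = 1 := by
  rw [walkRatio, walkCount_eq_walkWeight r v hr, div_self]
  exact (mul_pos (walkWeight_pos _ _) hK).ne'

/-- The factor `(d + 2r)!` of the weight cancels the Poisson denominator, which leaves the
exponential series in `c ^ 2`. -/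
lemma pow_div_mul_walkCount (hK : 0 < geodesicCount v) (c : ℝ) (r : ℕ) :
    c ^ (latticeNorm v + 2 * r) / (latticeNorm v + 2 * r)! * walkCount (latticeNorm v + 2 * r) v
      = c ^ latticeNorm v * geodesicCount v / (latticeNorm v)! *
        ((c ^ 2) ^ r / r ! * walkRatio v r) := by
  rw [walkRatio, walkWeight, pow_add, pow_mul]
  field_simp

lemma summable_walkRatio (q : ℝ) : Summable fun r => q ^ r / r ! * walkRatio v r := by
  refine Summable.of_norm_bounded (g := fun r => |q| ^ r / r !)
    (Real.summable_pow_div_factorial _) fun r => ?_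
  rw [norm_mul, norm_div, norm_pow, Real.norm_eq_abs, Real.norm_natCast, Real.norm_eq_abs,
    abs_of_nonneg (walkRatio_nonneg r)]
  exact mul_le_of_le_one_right (by positivity) (walkRatio_le_one r)

lemma hasSum_exp (q : ℝ) : HasSum (fun r : ℕ => q ^ r / r !) (Real.exp q) := by
  rw [Real.exp_eq_exp_ℝ]
  exact NormedSpace.expSeries_div_hasSum_exp q

lemma summable_sq_mul_pow_div_factorial (q : ℝ) :
    Summable fun r : ℕ => (r : ℝ) ^ 2 * (q ^ r / r !) := by
  refine Summable.of_norm_bounded (g := fun r : ℕ => (4 * |q|) ^ r / r !)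
    (Real.summable_pow_div_factorial _) fun r => ?_
  rw [norm_mul, norm_div, norm_pow, norm_pow, Real.norm_natCast, Real.norm_natCast,
    Real.norm_eq_abs, mul_pow, mul_div_assoc]
  gcongr
  have : r ^ 2 ≤ (2 ^ r) ^ 2 := Nat.pow_le_pow_left Nat.lt_two_pow_self.le 2
  calc (r : ℝ) ^ 2 ≤ ((2 : ℝ) ^ r) ^ 2 := by exact_mod_cast this
    _ = 4 ^ r := by rw [← pow_mul, mul_comm, pow_mul]; norm_num

/-- The generating function of the walk counts agrees with its stable value up to a factor
`1 + O(1 / n²)`. -/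
lemma exists_tsum_walkCount_eq (hK : 0 < geodesicCount v) {b : ℕ} (hb : latticeNorm v ≤ b)
    (hn : 4 * b ≤ n) {c M : ℝ} (hc : 0 ≤ c) (hM : c ≤ M) (hn0 : 0 < n) :
    ∃ ε : ℝ, |ε| ≤ 16 * (∑' r : ℕ, (r : ℝ) ^ 2 * ((M ^ 2) ^ r / r !)) / n ^ 2 ∧
      ∑' m, c ^ m / m ! * walkCount m v
        = c ^ latticeNorm v * geodesicCount v / (latticeNorm v)! * Real.exp (c ^ 2) * (1 + ε) := by
  have hS := summable_walkRatio (v := v) (c ^ 2)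
  have hE := hasSum_exp (c ^ 2)
  refine ⟨Real.exp (-c ^ 2) * (∑' r, (c ^ 2) ^ r / r ! * walkRatio v r - Real.exp (c ^ 2)), ?_, ?_⟩
  · rw [abs_mul, abs_of_pos (Real.exp_pos _), ← hE.tsum_eq, ← hS.tsum_sub hE.summable]
    have hbound : ∀ r : ℕ, ‖(c ^ 2) ^ r / r ! * walkRatio v r - (c ^ 2) ^ r / (r ! : ℝ)‖
        ≤ 16 / (n : ℝ) ^ 2 * ((r : ℝ) ^ 2 * ((M ^ 2) ^ r / r !)) := by
      intro r
      -- In the stable range the terms agree. Outside it, `4 * latticeNorm v ≤ n` forces `n ≤ 4 *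
      -- r`, so the factor `16 * r ^ 2 / n ^ 2` is at least `1`.
      by_cases hr : latticeNorm v + 2 * r + latticeNorm v < n + 1
      · rw [walkRatio_eq_one hK hr, mul_one, sub_self, norm_zero]
        positivity
      · have h4 : n ≤ 4 * r := by omega
        have h4' : (n : ℝ) ≤ 4 * r := by exact_mod_cast h4
        have hone : 1 ≤ 16 / (n : ℝ) ^ 2 * (r : ℝ) ^ 2 := by
          rw [div_mul_eq_mul_div, le_div_iff₀ (by positivity)]
          nlinarith [(Nat.cast_nonneg n : (0 : ℝ) ≤ n)]
        have h0 := walkRatio_nonneg (v := v) r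
        have h1 := walkRatio_le_one (v := v) r
        calc ‖(c ^ 2) ^ r / r ! * walkRatio v r - (c ^ 2) ^ r / (r ! : ℝ)‖
            = (c ^ 2) ^ r / r ! * |walkRatio v r - 1| := by
              rw [← mul_sub_one, norm_mul, Real.norm_of_nonneg (by positivity), Real.norm_eq_abs]
          _ ≤ (M ^ 2) ^ r / r ! * 1 := by
              gcongr
              rw [abs_le]; constructor <;> linarith
          _ ≤ (M ^ 2) ^ r / r ! * (16 / (n : ℝ) ^ 2 * (r : ℝ) ^ 2) := by
              gcongr
          _ = _ := by ring
    have hsum := (summable_sq_mul_pow_div_factorial (M ^ 2)).mul_left (16 / (n : ℝ) ^ 2)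
    have h := tsum_of_norm_bounded hsum.hasSum hbound
    rw [Real.norm_eq_abs, tsum_mul_left] at h
    have hexp : Real.exp (-c ^ 2) ≤ 1 := Real.exp_le_one_iff.2 (by nlinarith)
    calc _ ≤ 1 * _ := mul_le_mul hexp h (abs_nonneg _) zero_le_one
      _ = _ := by ring
  · rw [tsum_walkCount_eq]
    simp only [pow_div_mul_walkCount hK]
    rw [tsum_mul_left, mul_assoc _ (Real.exp _)]
    congr 1
    rw [mul_add, ← mul_assoc, ← Real.exp_add]
    simp

end Series

/-! ### The lazy walk in discrete time -/

section Binomial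

variable {n : ℕ} (c₀ c₁ : ℝ)

/-- The lattice walk that at each time rests with weight `c₀` and makes each of the elementary
steps with weight `c₁`: the total weight of the walks of length `k` from `0` to `v` that stay
monotone. -/
noncomputable def lazyWalkWeight (k : ℕ) (v : Fin (n + 1) → ℤ) : ℝ :=
  ∑ m ∈ Finset.range (k + 1), k.choose m * c₀ ^ (k - m) * c₁ ^ m * walkCount m v

variable {c₀ c₁}

lemma lazyWalkWeight_zero (v : Fin (n + 1) → ℤ) [Decidable (v = 0)] :
    lazyWalkWeight c₀ c₁ 0 v = if v = 0 then 1 else 0 := by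
  rw [lazyWalkWeight, zero_add, Finset.sum_range_one, walkCount]
  simp

lemma lazyWalkWeight_of_not_monotone (k : ℕ) {v : Fin (n + 1) → ℤ} (h : ¬ Monotone v) :
    lazyWalkWeight c₀ c₁ k v = 0 :=
  Finset.sum_eq_zero fun m _ => by rw [walkCount_of_not_monotone m h, mul_zero]

lemma lazyWalkWeight_succ (k : ℕ) {v : Fin (n + 1) → ℤ} (h : Monotone v) :
    lazyWalkWeight c₀ c₁ (k + 1) v = c₀ * lazyWalkWeight c₀ c₁ k v
      + c₁ * ∑ e, lazyWalkWeight c₀ c₁ k (v + latticeStep e) := by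
  have h1 : ∑ e, lazyWalkWeight c₀ c₁ k (v + latticeStep e)
      = ∑ m ∈ Finset.range (k + 1), k.choose m * c₀ ^ (k - m) * c₁ ^ m * walkCount (m + 1) v := by
    simp only [lazyWalkWeight]
    rw [Finset.sum_comm]
    refine Finset.sum_congr rfl fun m _ => ?_
    rw [walkCount_succ _ h, Finset.mul_sum]
  have h2 : c₀ * lazyWalkWeight c₀ c₁ k v = ∑ m ∈ Finset.range (k + 1),
      k.choose (m + 1) * c₀ ^ (k - m) * c₁ ^ (m + 1) * walkCount (m + 1) v
        + c₀ ^ (k + 1) * walkCount 0 v := by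
    rw [Finset.sum_range_succ, Nat.choose_succ_self, lazyWalkWeight, Finset.sum_range_succ',
      mul_add, Finset.mul_sum]
    congr 1
    · rw [Nat.cast_zero, zero_mul, zero_mul, zero_mul, add_zero]
      refine Finset.sum_congr rfl fun m hm => ?_
      obtain ⟨l, rfl⟩ := Nat.exists_eq_add_of_lt (Finset.mem_range.1 hm)
      rw [show m + l + 1 - (m + 1) = l by omega, show m + l + 1 - m = l + 1 by omega, pow_succ]
      ring
    · rw [pow_succ]
      simp
      ring
  rw [h1, h2, lazyWalkWeight, Finset.sum_range_succ', Finset.mul_sum, add_right_comm,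
    ← Finset.sum_add_distrib]
  congr 1
  · refine Finset.sum_congr rfl fun m _ => ?_
    rw [Nat.choose_succ_succ, Nat.add_sub_add_right, pow_succ]
    push_cast
    ring
  · simp

/-- A unit step can repair a descent of `v` only if the descent is by exactly `1`, and then two
coordinates of `x + v` coincide. So unit steps cannot change the order of the walks without a
collision. -/
lemma monotone_of_monotone_add_step {x v : Fin (n + 1) → ℤ} (hx : ∀ j, x j = (j : ℤ) + 1)
    (hinj : Function.Injective (x + v)) {e : Fin (n + 1) × Bool}
    (h : Monotone (v + latticeStep e)) : Monotone v := by
  refine Fin.monotone_iff_le_succ.2 fun i => ?_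
  have h1 := Fin.monotone_iff_le_succ.1 h i
  have h2 : (x + v) i.castSucc ≠ (x + v) i.succ := fun h => (Fin.castSucc_lt_succ (i := i)).ne (hinj h)
  have h3 : i.castSucc ≠ i.succ := (Fin.castSucc_lt_succ (i := i)).ne
  simp only [Pi.add_apply, latticeStep_apply, hx, Fin.val_castSucc, Fin.val_succ] at h1 h2
  push_cast at h2
  split_ifs at h1 <;> omega

lemma injective_of_monotone {x v : Fin (n + 1) → ℤ} (hx : ∀ j, x j = (j : ℤ) + 1)
    (h : Monotone v) : Function.Injective (x + v) := by
  refine StrictMono.injective (Fin.strictMono_iff_lt_succ.2 fun i => ?_)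
  have := Fin.monotone_iff_le_succ.1 h i
  simp [hx]
  omega

/-- The lazy walk recursion, for endpoints with distinct coordinates. -/
lemma lazyWalkWeight_succ_of_injective (k : ℕ) {x v : Fin (n + 1) → ℤ}
    (hx : ∀ j, x j = (j : ℤ) + 1) (hinj : Function.Injective (x + v)) :
    lazyWalkWeight c₀ c₁ (k + 1) v = c₀ * lazyWalkWeight c₀ c₁ k v
      + c₁ * ∑ e, lazyWalkWeight c₀ c₁ k (v + latticeStep e) := by
  by_cases h : Monotone v
  · exact lazyWalkWeight_succ k h
  · rw [lazyWalkWeight_of_not_monotone _ h, lazyWalkWeight_of_not_monotone _ h,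
      Finset.sum_eq_zero fun e _ => lazyWalkWeight_of_not_monotone _ fun h' =>
        h (monotone_of_monotone_add_step hx hinj h')]
    simp

end Binomial

/-! ### Survival of chains with independent increments -/

section Chain

variable {N : ℕ} {Ω : Type*} {x : Fin N → ℤ}
  {V : ℕ → Ω → Fin N → ℤ}

/-- The position after `k` increments. -/
def chainPosition (x : Fin N → ℤ) (V : ℕ → Ω → Fin N → ℤ) (k : ℕ) (ω : Ω) : Fin N → ℤ :=
  x + ∑ i ∈ Finset.range k, V i ω

/-- The event that the coordinates are distinct up to time `k`, and the position at time `k`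
is `z`. -/
def survivalEvent (x : Fin N → ℤ) (V : ℕ → Ω → Fin N → ℤ) (k : ℕ) (z : Fin N → ℤ) : Set Ω :=
  {ω | (∀ i ≤ k, Function.Injective (chainPosition x V i ω)) ∧ chainPosition x V k ω = z}

/-- Survival up to time `k` depends only on the first `k` increments, hence is independent of the
next one. -/
lemma survivalEvent_eq_preimage (k : ℕ) (z : Fin N → ℤ) :
    ∃ B : Set (Finset.range k → Fin N → ℤ),
      survivalEvent x V k z = (fun ω (i : Finset.range k) => V i ω) ⁻¹' B := by
  refine ⟨(fun ω (i : Finset.range k) => V i ω) '' survivalEvent x V k z,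
    (Set.subset_preimage_image _ _).antisymm ?_⟩
  rintro ω ⟨ω', hω', heq⟩
  have h : ∀ i ≤ k, chainPosition x V i ω' = chainPosition x V i ω := fun i hi => by
    rw [chainPosition, chainPosition]
    congr 1
    refine Finset.sum_congr rfl fun l hl => ?_
    exact congrFun heq ⟨l, Finset.mem_range.2 ((Finset.mem_range.1 hl).trans_le hi)⟩
  exact ⟨fun i hi => h i hi ▸ hω'.1 i hi, h k le_rfl ▸ hω'.2⟩

lemma mem_survivalEvent_succ {k : ℕ} {z : Fin N → ℤ} (hz : Function.Injective z) {ω : Ω} :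
    ω ∈ survivalEvent x V (k + 1) z ↔ ω ∈ survivalEvent x V k (z - V k ω) := by
  have hpos : chainPosition x V (k + 1) ω = chainPosition x V k ω + V k ω := by
    rw [chainPosition, chainPosition, Finset.sum_range_succ, add_assoc]
  constructor
  · rintro ⟨h1, h2⟩
    exact ⟨fun i hi => h1 i (by omega), by rw [← h2, hpos, add_sub_cancel_right]⟩
  · rintro ⟨h1, h2⟩
    have h3 : chainPosition x V (k + 1) ω = z := by rw [hpos, h2, sub_add_cancel]
    refine ⟨fun i hi => ?_, h3⟩
    rcases hi.eq_or_lt with rfl | hi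
    · rwa [h3]
    · exact h1 i (by omega)

variable [MeasurableSpace Ω] {μ : Measure Ω}

lemma measurableSet_survivalEvent (hV : ∀ i, Measurable (V i)) (k : ℕ) (z : Fin N → ℤ) :
    MeasurableSet (survivalEvent x V k z) := by
  obtain ⟨B, hB⟩ := survivalEvent_eq_preimage (x := x) (V := V) k z
  rw [hB]
  exact measurable_pi_lambda (fun ω (i : Finset.range k) => V i ω) (fun i => hV i)
    MeasurableSet.of_discrete

lemma measure_survivalEvent_inter (hV : ∀ i, Measurable (V i)) (hind : iIndepFun V μ) (k : ℕ)
    (z v : Fin N → ℤ) :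
    μ.real (survivalEvent x V k z ∩ {ω | V k ω = v})
      = μ.real (survivalEvent x V k z) * μ.real {ω | V k ω = v} := by
  obtain ⟨B, hB⟩ := survivalEvent_eq_preimage (x := x) (V := V) k z
  have h := hind.indepFun_finset (Finset.range k) {k} (by simp) hV
  have h2 := h.measure_inter_preimage_eq_mul B
    ((fun u : ({k} : Finset ℕ) → Fin N → ℤ => u ⟨k, Finset.mem_singleton_self k⟩) ⁻¹' {v})
    MeasurableSet.of_discrete
    MeasurableSet.of_discrete
  rw [← hB] at h2
  rw [measureReal_def, measureReal_def, measureReal_def, ← ENNReal.toReal_mul]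
  exact congrArg _ h2

/-- The elementary moves of the lazy walk. -/
def lazyMove : Option (Fin N × Bool) → Fin N → ℤ
  | none => 0
  | some e => -latticeStep e

lemma lazyMove_injective : Function.Injective (lazyMove (N := N)) := by
  rintro (_ | e) (_ | e') h
  · rfl
  · exact absurd h.symm (neg_ne_zero.2 (latticeStep_ne_zero e'))
  · exact absurd h (neg_ne_zero.2 (latticeStep_ne_zero e))
  · exact congrArg some (latticeStep_injective (neg_injective h))

variable [IsProbabilityMeasure μ]

lemma sum_measure_lazyMove_le_one (hV : ∀ i, Measurable (V i)) (k : ℕ) :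
    ∑ o, μ.real {ω | V k ω = lazyMove o} ≤ 1 := by
  have hd : (Set.univ : Set (Option (Fin N × Bool))).PairwiseDisjoint
      fun o => {ω | V k ω = lazyMove o} := by
    intro o _ o' _ hne
    refine Set.disjoint_left.2 fun ω h h' => hne (lazyMove_injective ?_)
    exact (Eq.symm h).trans h'
  rw [← measureReal_biUnion_finset (f := fun o => {ω | V k ω = lazyMove o}) (by simpa using hd)
    fun o _ => hV k (measurableSet_singleton _)]
  exact measureReal_le_one

/-- Condition on the last increment. Discarding all but the weights `c` of the lazy moves gives the
lower bound, and the discarded mass is at most `1 - ∑ o, c o`. -/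
lemma survivalEvent_succ_bounds (hV : ∀ i, Measurable (V i)) (hind : iIndepFun V μ) (k : ℕ)
    {z : Fin N → ℤ} (hz : Function.Injective z) (c : Option (Fin N × Bool) → ℝ)
    (hc : ∀ o, c o ≤ μ.real {ω | V k ω = lazyMove o}) :
    ∑ o, c o * μ.real (survivalEvent x V k (z - lazyMove o))
        ≤ μ.real (survivalEvent x V (k + 1) z) ∧
      μ.real (survivalEvent x V (k + 1) z)
        ≤ ∑ o, c o * μ.real (survivalEvent x V k (z - lazyMove o)) + (1 - ∑ o, c o) := by
  set E : Option (Fin N × Bool) → Set Ω := fun o => {ω | V k ω = lazyMove o} with hE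
  have hEm : ∀ o, MeasurableSet (E o) := fun o => hV k (measurableSet_singleton _)
  have hEd : ((Finset.univ : Finset (Option (Fin N × Bool))) : Set _).PairwiseDisjoint E := by
    intro o _ o' _ hne
    refine Set.disjoint_left.2 fun ω h h' => hne (lazyMove_injective ?_)
    exact (Eq.symm h).trans h'
  set U : Set Ω := ⋃ o ∈ (Finset.univ : Finset (Option (Fin N × Bool))), E o with hU
  have hUm : MeasurableSet U := Finset.measurableSet_biUnion _ fun o _ => hEm o
  set A := survivalEvent x V (k + 1) z with hA
  have hAm : MeasurableSet A := measurableSet_survivalEvent hV _ _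
  have hUr : μ.real U = ∑ o, μ.real (E o) := measureReal_biUnion_finset hEd fun o _ => hEm o
  have hAE : ∀ o, A ∩ E o = survivalEvent x V k (z - lazyMove o) ∩ E o := by
    intro o
    ext ω
    refine and_congr_left fun h => ?_
    rw [hA, mem_survivalEvent_succ hz, show V k ω = lazyMove o from h]
  have hAU : μ.real (A ∩ U)
      = ∑ o, μ.real (survivalEvent x V k (z - lazyMove o)) * μ.real (E o) := by
    rw [hU, Set.inter_iUnion₂, measureReal_biUnion_finset]
    · refine Finset.sum_congr rfl fun o _ => ?_
      rw [hAE]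
      exact measure_survivalEvent_inter hV hind k _ _
    · exact hEd.mono fun o => Set.inter_subset_right
    · exact fun o _ => hAm.inter (hEm o)
  have hsplit : μ.real A = μ.real (A ∩ U) + μ.real (A \ U) := (measureReal_inter_add_sdiff hUm).symm
  have hdiff : μ.real (A \ U) ≤ 1 - ∑ o, μ.real (E o) := by
    rw [← hUr, ← probReal_compl_eq_one_sub hUm]
    exact measureReal_mono fun ω h => h.2
  have hlow : ∑ o, c o * μ.real (survivalEvent x V k (z - lazyMove o)) ≤ μ.real (A ∩ U) := by
    rw [hAU]
    refine Finset.sum_le_sum fun o _ => ?_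
    rw [mul_comm]
    exact mul_le_mul_of_nonneg_left (hc o) measureReal_nonneg
  refine ⟨hlow.trans (hsplit ▸ le_add_of_nonneg_right measureReal_nonneg), ?_⟩
  have hup : μ.real (A ∩ U) ≤ ∑ o, c o * μ.real (survivalEvent x V k (z - lazyMove o))
      + (∑ o, μ.real (E o) - ∑ o, c o) := by
    rw [hAU, ← Finset.sum_sub_distrib, ← Finset.sum_add_distrib]
    refine Finset.sum_le_sum fun o _ => ?_
    have h1 : μ.real (survivalEvent x V k (z - lazyMove o)) ≤ 1 := measureReal_le_one
    have h2 := hc o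
    nlinarith [mul_nonneg (sub_nonneg.2 h1) (sub_nonneg.2 h2)]
  linarith

end Chain

/-! ### Comparison of the chain with the lazy walk -/

section ChainLimit

variable {n : ℕ} {Ω : Type*} [MeasurableSpace Ω] {μ : Measure Ω} [IsProbabilityMeasure μ]
  {x : Fin (n + 1) → ℤ} {V : ℕ → Ω → Fin (n + 1) → ℤ}

/-- The survival probabilities of a chain with independent increments are close to the weights of
the lazy walk, if the increments are close to those of the lazy walk. -/
lemma survivalEvent_sub_lazyWalkWeight (hV : ∀ i, Measurable (V i)) (hind : iIndepFun V μ)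
    (hx : ∀ j, x j = (j : ℤ) + 1) {c₀ c₁ : ℝ} (h₀ : 0 ≤ c₀) (h₁ : 0 ≤ c₁)
    (hQ₀ : ∀ k, c₀ ≤ μ.real {ω | V k ω = 0})
    (hQ₁ : ∀ k e, c₁ ≤ μ.real {ω | V k ω = latticeStep e}) (k : ℕ) (v : Fin (n + 1) → ℤ) :
    0 ≤ μ.real (survivalEvent x V k (x + v)) - lazyWalkWeight c₀ c₁ k v ∧
      μ.real (survivalEvent x V k (x + v)) - lazyWalkWeight c₀ c₁ k v
        ≤ k * (1 - (c₀ + 2 * (n + 1) * c₁)) := by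
  classical
  set c : Option (Fin (n + 1) × Bool) → ℝ := fun o => o.elim c₀ fun _ => c₁ with hc
  have hcQ : ∀ k o, c o ≤ μ.real {ω | V k ω = lazyMove o} := by
    rintro k (_ | ⟨j, s⟩)
    · exact hQ₀ k
    · simpa [lazyMove, hc, ← latticeStep_flip] using hQ₁ k (j, !s)
  have hcsum : ∑ o, c o = c₀ + 2 * (n + 1) * c₁ := by
    rw [Fintype.sum_option]
    simp only [hc, Option.elim, Finset.sum_const, Finset.card_univ, Fintype.card_prod,
      Fintype.card_fin, Fintype.card_bool, nsmul_eq_mul]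
    push_cast
    ring
  have hρ : 0 ≤ 1 - (c₀ + 2 * (n + 1) * c₁) := by
    rw [← hcsum, sub_nonneg]
    exact (Finset.sum_le_sum fun o _ => hcQ 0 o).trans (sum_measure_lazyMove_le_one hV 0)
  induction k generalizing v with
  | zero =>
    have hx' : Function.Injective x := by
      simpa using injective_of_monotone (v := 0) hx fun _ _ _ => le_rfl
    rw [lazyWalkWeight_zero]
    by_cases hv : v = 0
    · have : survivalEvent x V 0 (x + v) = Set.univ := by
        ext ω
        simp [survivalEvent, chainPosition, hv, hx']
      rw [this, if_pos hv]
      simp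
    · have : survivalEvent x V 0 (x + v) = ∅ := by
        ext ω
        simp [survivalEvent, chainPosition, hx', hv]
      rw [this, if_neg hv]
      simp
  | succ k ih =>
    by_cases hz : Function.Injective (x + v)
    swap
    · have : survivalEvent x V (k + 1) (x + v) = ∅ := by
        ext ω
        simp only [survivalEvent, Set.mem_ofPred_eq, Set.mem_empty_iff_false, iff_false]
        rintro ⟨h1, h2⟩
        exact hz (h2 ▸ h1 (k + 1) le_rfl)
      rw [this, lazyWalkWeight_of_not_monotone _ (mt (injective_of_monotone hx) hz)]
      simp only [measureReal_empty, sub_self, le_refl, true_and]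
      positivity
    obtain ⟨hlow, hup⟩ := survivalEvent_succ_bounds (x := x) hV hind k hz c (hcQ k)
    have hsum : ∑ o, c o * μ.real (survivalEvent x V k (x + v - lazyMove o))
        = c₀ * μ.real (survivalEvent x V k (x + v))
          + c₁ * ∑ e, μ.real (survivalEvent x V k (x + (v + latticeStep e))) := by
      rw [Fintype.sum_option, Finset.mul_sum]
      simp [hc, lazyMove, add_assoc]
    rw [hsum] at hlow hup
    rw [hcsum] at hup
    rw [lazyWalkWeight_succ_of_injective k hx hz]
    have hl : c₁ * ∑ e, lazyWalkWeight c₀ c₁ k (v + latticeStep e)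
        ≤ c₁ * ∑ e, μ.real (survivalEvent x V k (x + (v + latticeStep e))) :=
      mul_le_mul_of_nonneg_left (Finset.sum_le_sum fun e _ => sub_nonneg.1 (ih _).1) h₁
    have hl0 := mul_le_mul_of_nonneg_left (sub_nonneg.1 (ih v).1) h₀
    have hu : c₁ * ∑ e, μ.real (survivalEvent x V k (x + (v + latticeStep e)))
        ≤ c₁ * ∑ e, (lazyWalkWeight c₀ c₁ k (v + latticeStep e)
            + k * (1 - (c₀ + 2 * (n + 1) * c₁))) :=
      mul_le_mul_of_nonneg_left (Finset.sum_le_sum fun e _ => by linarith [(ih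
        (v + latticeStep e)).2]) h₁
    rw [Finset.sum_add_distrib, Finset.sum_const, Finset.card_univ] at hu
    simp only [Fintype.card_prod, Fintype.card_fin, Fintype.card_bool, nsmul_eq_mul] at hu
    push_cast at hu ⊢
    have hu0 := mul_le_mul_of_nonneg_left (sub_le_iff_le_add.1 (ih v).2) h₀
    -- The weights of the lazy walk sum to at most `1`, so averaging does not enlarge the inherited
    -- error, and each step adds one defect.
    have hk : 0 ≤ (k : ℝ) * (1 - (c₀ + 2 * (n + 1) * c₁)) := by positivity
    constructor
    · linarith
    · nlinarith [mul_nonneg hk hρ]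

end ChainLimit

/-! ### Independence of rows and columns of a doubly indexed family -/

section Independence

variable {Ω : Type*} [MeasurableSpace Ω] {μ : Measure Ω}

/-- A doubly indexed independent family gives independent rows. -/
lemma iIndepFun_curry {ι κ 𝓧 : Type*} [MeasurableSpace 𝓧] {X : ι → κ → Ω → 𝓧}
    (hX : ∀ i k, Measurable (X i k)) (h : iIndepFun (fun p : ι × κ => X p.1 p.2) μ) :
    iIndepFun (fun i ω k => X i k ω) μ := by
  have := h.isProbabilityMeasure
  have hp : ∀ i k, IsProbabilityMeasure (μ.map (X i k)) :=
    fun i k => Measure.isProbabilityMeasure_map (hX i k).aemeasurable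
  have hm : ∀ i, Measurable fun ω k => X i k ω := fun i => measurable_pi_lambda _ (hX i)
  have hrow : ∀ i, μ.map (fun ω k => X i k ω) = Measure.infinitePi fun k => μ.map (X i k) :=
    fun i => (h.precomp (g := fun k => (i, k)) (Prod.mk_right_injective i)).map_fun_eq_infinitePi_map
      (hX i)
  have hall : μ.map (fun ω (p : ι × κ) => X p.1 p.2 ω)
      = Measure.infinitePi fun p : ι × κ => μ.map (X p.1 p.2) :=
    h.map_fun_eq_infinitePi_map fun p => hX p.1 p.2
  rw [iIndepFun_iff_map_fun_eq_infinitePi_map hm]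
  simp only [hrow]
  rw [← Measure.infinitePi_map_curry fun i k => μ.map (X i k),
    ← hall]
  exact (Measure.map_map (MeasurableEquiv.curry ι κ 𝓧).measurable
    (measurable_pi_lambda _ fun p => hX p.1 p.2)).symm

/-- The transpose of an independent family of sequences with independent terms. -/
lemma iIndepFun_transpose {ι κ 𝓧 : Type*} [MeasurableSpace 𝓧] {X : ι → κ → Ω → 𝓧}
    (hX : ∀ i k, Measurable (X i k)) (h1 : iIndepFun (fun i ω k => X i k ω) μ)
    (h2 : ∀ i, iIndepFun (X i) μ) : iIndepFun (fun k ω i => X i k ω) μ :=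
  iIndepFun_curry (X := fun k i => X i k) (fun k i => hX i k)
    ((iIndepFun_uncurry' hX h1 h2).precomp (g := Prod.swap) Prod.swap_injective)

lemma iIndepFun_bool {𝓧 : Type*} [MeasurableSpace 𝓧] [IsProbabilityMeasure μ] {f g : Ω → 𝓧}
    (h : IndepFun f g μ) :
    iIndepFun (fun (s : Bool) => if s then f else g) μ := by
  classical
  rw [iIndepFun_iff_measure_inter_preimage_eq_mul]
  intro S sets hS
  by_cases ht : true ∈ S <;> by_cases hf : false ∈ S
  · obtain rfl : S = {true, false} := by ext s; cases s <;> simp [ht, hf]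
    rw [Finset.set_biInter_insert, Finset.set_biInter_singleton, Finset.prod_pair (by simp)]
    exact h.measure_inter_preimage_eq_mul _ _ (hS true ht) (hS false hf)
  · obtain rfl : S = {true} := by ext s; cases s <;> simp [ht, hf]
    simp
  · obtain rfl : S = {false} := by ext s; cases s <;> simp [ht, hf]
    simp
  · obtain rfl : S = ∅ := by ext s; cases s <;> simp [ht, hf]
    simp

end Independence

/-! ### Increments of a single walk -/

section Walk

variable {Ω : Type*} [MeasurableSpace Ω] {μ : Measure Ω} {X : ℝ≥0 → Ω → ℤ} {x : ℤ}

lemma IsContinuousTimeRandomWalk.measurable (h : IsContinuousTimeRandomWalk X x μ) (t : ℝ≥0) :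
    Measurable (X t) := by
  obtain ⟨N₁, N₂, h1, h2, -, hX⟩ := h
  have : X t = fun ω => x + (N₁ t ω : ℤ) - (N₂ t ω : ℤ) := funext (hX t)
  rw [this]
  have hc : Measurable fun k : ℕ => (k : ℤ) := measurable_from_top
  exact (measurable_const.add (hc.comp (h1.measurable t))).sub (hc.comp (h2.measurable t))

lemma IsPoissonProcess.measurable_increment {N : ℝ≥0 → Ω → ℕ} {r : ℝ≥0}
    (h : IsPoissonProcess N r μ) (s t : ℝ≥0) : Measurable fun ω => N t ω - N s ω :=
  (h.measurable t).sub (h.measurable s)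

lemma IsPoissonProcess.measureReal_increment_eq {N : ℝ≥0 → Ω → ℕ} {r : ℝ≥0}
    (h : IsPoissonProcess N r μ) {s t : ℝ≥0} (hst : s ≤ t) (k : ℕ) :
    μ.real {ω | N t ω - N s ω = k}
      = Real.exp (-(r * (t - s) : ℝ≥0)) * (r * (t - s) : ℝ≥0) ^ k / k ! := by
  rw [← poissonMeasure_real_singleton, measureReal_def, measureReal_def]
  congr 1
  exact (h.law s t hst).measure_eq (p := fun m => m = k) (measurableSet_singleton k)

/-- Almost surely, the increment of the walk is the difference of the truncated increments. -/
lemma ae_increment_eq {N₁ N₂ : ℝ≥0 → Ω → ℕ} {r : ℝ≥0} (h1 : IsPoissonProcess N₁ r μ)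
    (h2 : IsPoissonProcess N₂ r μ) (hX : ∀ t ω, X t ω = x + (N₁ t ω : ℤ) - (N₂ t ω : ℤ))
    {s t : ℝ≥0} (hst : s ≤ t) :
    (fun ω => ((N₁ t ω - N₁ s ω : ℕ) : ℤ) - ((N₂ t ω - N₂ s ω : ℕ) : ℤ))
      =ᵐ[μ] fun ω => X t ω - X s ω := by
  filter_upwards [h1.mono, h2.mono] with ω hω1 hω2
  have := hω1 hst
  have := hω2 hst
  simp only at *
  rw [hX, hX]
  omega

lemma IsContinuousTimeRandomWalk.iIndepFun_increment [IsProbabilityMeasure μ]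
    (h : IsContinuousTimeRandomWalk X x μ) {t : ℕ → ℝ≥0} (ht : Monotone t) :
    iIndepFun (fun i ω => X (t (i + 1)) ω - X (t i) ω) μ := by
  obtain ⟨N₁, N₂, h1, h2, hind, hX⟩ := h
  set D : Bool → ℕ → Ω → ℕ := fun s i ω =>
    if s then N₁ (t (i + 1)) ω - N₁ (t i) ω else N₂ (t (i + 1)) ω - N₂ (t i) ω with hD
  have hDm : ∀ s i, Measurable (D s i) := by
    rintro (_ | _) i
    · simpa [hD] using h2.measurable_increment (t i) (t (i + 1))
    · simpa [hD] using h1.measurable_increment (t i) (t (i + 1))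
  have hφ : Measurable fun (f : ℝ≥0 → ℕ) (i : ℕ) => f (t (i + 1)) - f (t i) :=
    measurable_pi_lambda _ fun i => (measurable_pi_apply _).sub (measurable_pi_apply _)
  have hrow : iIndepFun (fun s ω i => D s i ω) μ := by
    have := iIndepFun_bool (hind.comp hφ hφ)
    convert this using 2 with s
    cases s <;> rfl
  have hterm : ∀ s, iIndepFun (D s) μ := by
    rintro (_ | _)
    · exact h2.indep.nat ht
    · exact h1.indep.nat ht
  have hT := iIndepFun_transpose hDm hrow hterm
  have hd : Measurable fun u : Bool → ℕ => (u true : ℤ) - (u false : ℤ) := .of_discrete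
  refine (hT.comp (fun _ => fun u : Bool → ℕ => (u true : ℤ) - (u false : ℤ)) fun _ => hd).congr ?_
  intro i
  exact ae_increment_eq h1 h2 hX (ht i.le_succ)

lemma IsContinuousTimeRandomWalk.increment_lower_bounds [IsProbabilityMeasure μ]
    (h : IsContinuousTimeRandomWalk X x μ) {s t : ℝ≥0} (hst : s ≤ t) :
    Real.exp (-(t - s)) ≤ μ.real {ω | X t ω - X s ω = 0} ∧
    Real.exp (-(t - s)) * ((t - s) / 2) ≤ μ.real {ω | X t ω - X s ω = 1} ∧
    Real.exp (-(t - s)) * ((t - s) / 2) ≤ μ.real {ω | X t ω - X s ω = -1} := by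
  obtain ⟨N₁, N₂, h1, h2, hind, hX⟩ := h
  have hae := ae_increment_eq h1 h2 hX hst
  have hφ : Measurable fun f : ℝ≥0 → ℕ => f t - f s :=
    (measurable_pi_apply _).sub (measurable_pi_apply _)
  have hI := hind.comp hφ hφ
  -- The event that the two Poisson processes jump exactly `k` and `l` times is one way to obtain
  -- the increment `k - l`; the pairs `(0, 0)`, `(1, 0)` and `(0, 1)` suffice.
  have key : ∀ k l : ℕ, Real.exp (-(t - s)) * ((t - s) / 2) ^ (k + l) / (k ! * l !)
      ≤ μ.real {ω | X t ω - X s ω = (k : ℤ) - l} := by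
    intro k l
    have hprod : μ.real ({ω | N₁ t ω - N₁ s ω = k} ∩ {ω | N₂ t ω - N₂ s ω = l})
        = μ.real {ω | N₁ t ω - N₁ s ω = k} * μ.real {ω | N₂ t ω - N₂ s ω = l} := by
      rw [measureReal_def, measureReal_def, measureReal_def, ← ENNReal.toReal_mul]
      exact congrArg _ (hI.measure_inter_preimage_eq_mul {k} {l} (measurableSet_singleton _)
        (measurableSet_singleton _))
    rw [h1.measureReal_increment_eq hst, h2.measureReal_increment_eq hst] at hprod
    have hmono : μ.real ({ω | N₁ t ω - N₁ s ω = k} ∩ {ω | N₂ t ω - N₂ s ω = l})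
        ≤ μ.real {ω | X t ω - X s ω = (k : ℤ) - l} := by
      refine ENNReal.toReal_mono (measure_ne_top _ _) (measure_mono_ae ?_)
      filter_upwards [hae] with ω hω hkl
      have h1 : N₁ t ω - N₁ s ω = k := hkl.1
      have h2 : N₂ t ω - N₂ s ω = l := hkl.2
      simp only [h1, h2] at hω
      exact hω.symm
    refine le_trans (le_of_eq ?_) (hprod.symm.le.trans hmono)
    push_cast [NNReal.coe_sub hst]
    rw [show -((t : ℝ) - s) = -(1 / 2 * (t - s)) + -(1 / 2 * (t - s)) by ring, Real.exp_add]
    field_simp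
    ring
  refine ⟨?_, ?_, ?_⟩
  · simpa using key 0 0
  · simpa using key 1 0
  · simpa using key 0 1

end Walk

/-! ### Increments of the family of walks -/

section Family

variable {Ω : Type*} [MeasurableSpace Ω] {μ : Measure Ω} {N : ℕ}
  {X : Fin N → ℝ≥0 → Ω → ℤ} {x : Fin N → ℤ}

lemma IsIndepRandomWalks.iIndepFun_increment [IsProbabilityMeasure μ] (h : IsIndepRandomWalks X x μ) {t : ℕ → ℝ≥0}
    (ht : Monotone t) :
    iIndepFun (fun i ω j => X j (t (i + 1)) ω - X j (t i) ω) μ := by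
  refine iIndepFun_transpose (X := fun j i ω => X j (t (i + 1)) ω - X j (t i) ω)
    (fun j i => ((h.walk j).measurable _).sub ((h.walk j).measurable _)) ?_
    fun j => (h.walk j).iIndepFun_increment ht
  exact h.indep.comp (fun _ f i => f (t (i + 1)) - f (t i)) fun _ =>
    measurable_pi_lambda _ fun i => (measurable_pi_apply _).sub (measurable_pi_apply _)

lemma IsIndepRandomWalks.measureReal_increment_eq (h : IsIndepRandomWalks X x μ) (s t : ℝ≥0)
    (u : Fin N → ℤ) :
    μ.real {ω | (fun j => X j t ω - X j s ω) = u} = ∏ j, μ.real {ω | X j t ω - X j s ω = u j} := by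
  have hφ : Measurable fun f : ℝ≥0 → ℤ => f t - f s :=
    (measurable_pi_apply _).sub (measurable_pi_apply _)
  have hI := h.indep.comp (fun _ f => f t - f s) fun _ => hφ
  have := hI.measure_inter_preimage_eq_mul Finset.univ (sets := fun j => {u j})
    fun j _ => measurableSet_singleton _
  simp only [measureReal_def]
  rw [← ENNReal.toReal_prod]
  refine congrArg _ (Eq.trans ?_ this)
  congr 1
  ext ω
  simp [funext_iff]

variable [IsProbabilityMeasure μ]

lemma IsIndepRandomWalks.exp_le_measureReal_increment_zero (h : IsIndepRandomWalks X x μ)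
    {s t : ℝ≥0} (hst : s ≤ t) :
    Real.exp (-(N * (t - s))) ≤ μ.real {ω | (fun j => X j t ω - X j s ω) = 0} := by
  rw [h.measureReal_increment_eq, show -(N * ((t : ℝ) - s)) = ∑ _j : Fin N, -((t : ℝ) - s) by simp; ring,
    Real.exp_sum]
  exact Finset.prod_le_prod (fun _ _ => (Real.exp_pos _).le) fun j _ =>
    ((h.walk j).increment_lower_bounds hst).1

lemma IsIndepRandomWalks.exp_le_measureReal_increment_step (h : IsIndepRandomWalks X x μ)
    {s t : ℝ≥0} (hst : s ≤ t) (e : Fin N × Bool) :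
    Real.exp (-(N * (t - s))) * ((t - s) / 2)
      ≤ μ.real {ω | (fun j => X j t ω - X j s ω) = latticeStep e} := by
  rw [h.measureReal_increment_eq, show -(N * ((t : ℝ) - s)) = ∑ _j : Fin N, -((t : ℝ) - s) by simp; ring,
    Real.exp_sum, ← Finset.mul_prod_erase _ _ (Finset.mem_univ e.1),
    ← Finset.mul_prod_erase (Finset.univ : Finset (Fin N)) (fun j => μ.real _)
      (Finset.mem_univ e.1), mul_right_comm]
  have hst' : (0 : ℝ) ≤ t - s := sub_nonneg.2 hst
  refine mul_le_mul ?_ ?_ (by positivity) measureReal_nonneg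
  · rw [latticeStep_apply_self]
    split_ifs
    · exact ((h.walk e.1).increment_lower_bounds hst).2.1
    · exact ((h.walk e.1).increment_lower_bounds hst).2.2
  · refine Finset.prod_le_prod (fun _ _ => (Real.exp_pos _).le) fun j hj => ?_
    rw [latticeStep_apply_of_ne (Finset.ne_of_mem_erase hj)]
    exact ((h.walk j).increment_lower_bounds hst).1

end Family

/-! ### From binomial to Poisson weights -/

section LazyLimit

open Filter Topology

variable {n : ℕ}

lemma lazyWalkWeight_eq_tsum (h : ℝ) (a : ℝ) (k : ℕ) (v : Fin (n + 1) → ℤ) :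
    lazyWalkWeight a (a * h) k v = a ^ k * ∑' m, k.choose m * h ^ m * walkCount m v := by
  rw [tsum_eq_sum (s := Finset.range (k + 1)), lazyWalkWeight, Finset.mul_sum]
  · refine Finset.sum_congr rfl fun m hm => ?_
    obtain ⟨l, rfl⟩ := Nat.exists_eq_add_of_le (Nat.lt_succ_iff.1 (Finset.mem_range.1 hm))
    rw [Nat.add_sub_cancel_left, pow_add, mul_pow]
    ring
  · intro m hm
    rw [Nat.choose_eq_zero_of_lt (by simpa using hm)]
    simp

/-- Dominated convergence: each binomial weight is at most its Poisson limit `c ^ m / m !`. -/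
lemma tendsto_tsum_choose_mul_walkCount {c : ℝ} (hc : 0 ≤ c) (v : Fin (n + 1) → ℤ) :
    Tendsto (fun k : ℕ => ∑' m, k.choose m * (c / k) ^ m * walkCount m v) atTop
      (𝓝 (∑' m, c ^ m / m ! * walkCount m v)) := by
  refine tendsto_tsum_of_dominated_convergence (summable_walkCount c v) (fun m => ?_) ?_
  · refine (tendsto_choose_mul_pow_atTop m (p := fun k => c / k) ?_).mul_const _
    refine tendsto_const_nhds.congr' ?_
    filter_upwards [eventually_ge_atTop 1] with k hk
    field_simp
  · filter_upwards [eventually_ge_atTop 1] with k hk m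
    have hk' : (0 : ℝ) < k := by exact_mod_cast hk
    rw [Real.norm_of_nonneg (mul_nonneg (by positivity) (walkCount_nonneg _ _))]
    refine mul_le_mul_of_nonneg_right ?_ (walkCount_nonneg _ _)
    calc (k.choose m : ℝ) * (c / k) ^ m ≤ (k : ℝ) ^ m / m ! * (c / k) ^ m := by
          gcongr
          exact Nat.choose_le_pow_div m k
      _ = c ^ m / m ! := by
          rw [div_pow]
          field_simp

lemma tendsto_lazyWalkWeight {T : ℝ} (hT : 0 ≤ T) (v : Fin (n + 1) → ℤ) :
    Tendsto (fun k : ℕ => lazyWalkWeight (Real.exp (-((n + 1 : ℕ) * (T / k))))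
        (Real.exp (-((n + 1 : ℕ) * (T / k))) * (T / k / 2)) k v) atTop
      (𝓝 (Real.exp (-((n + 1 : ℕ) * T)) * ∑' m, (T / 2) ^ m / m ! * walkCount m v)) := by
  refine ((tendsto_tsum_choose_mul_walkCount (c := T / 2) (by positivity) v).const_mul _).congr' ?_
  filter_upwards [eventually_ge_atTop 1] with k hk
  have hk' : (0 : ℝ) < k := by exact_mod_cast hk
  rw [lazyWalkWeight_eq_tsum, ← Real.exp_nat_mul]
  congr 2
  · field_simp
  · simp only [div_right_comm]

end LazyLimit

/-! ### Sampling the paths on a grid -/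

section Grid

open Filter Topology

variable {N : ℕ} {Ω : Type*} {X : Fin N → ℝ≥0 → Ω → ℤ}
  {x : Fin N → ℤ}

/-- The increments of the walks over the steps of the grid with mesh `T / k`. -/
noncomputable def gridIncrement (X : Fin N → ℝ≥0 → Ω → ℤ) (T : ℝ≥0) (k i : ℕ) (ω : Ω) :
    Fin N → ℤ :=
  fun j => X j (T / k * (i + 1 : ℕ)) ω - X j (T / k * i) ω

/-- Rounding `t` up, rather than down, gives a point where right-continuity at `t` applies. -/
lemma exists_grid_point (T : ℝ≥0) {t : ℝ≥0} (ht : t ≤ T) {k : ℕ} (hk : 0 < k) :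
    ∃ i ≤ k, t ≤ T / k * i ∧ T / k * i ≤ t + T / k := by
  rcases eq_or_ne T 0 with rfl | hT
  · exact ⟨0, k.zero_le, by simpa using ht, by simp⟩
  have hk' : (k : ℝ≥0) ≠ 0 := by exact_mod_cast hk.ne'
  have hm : T / k ≠ 0 := div_ne_zero hT hk'
  refine ⟨⌈t / (T / k)⌉₊, ?_, ?_, ?_⟩
  · refine Nat.ceil_le.2 (div_le_of_le_mul₀ zero_le zero_le ?_)
    rwa [mul_div_cancel₀ _ hk']
  · have := Nat.le_ceil (t / (T / k))
    rwa [div_le_iff₀ (pos_iff_ne_zero.2 hm), mul_comm] at this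
  · have := (Nat.ceil_lt_add_one (zero_le (a := t / (T / k)))).le
    calc T / k * (⌈t / (T / k)⌉₊ : ℝ≥0) ≤ T / k * (t / (T / k) + 1) := by gcongr
      _ = t + T / k := by rw [mul_add, mul_one, mul_div_cancel₀ _ hm]

lemma chainPosition_gridIncrement {T : ℝ≥0} {ω : Ω} (h0 : ∀ j, X j 0 ω = x j) (k i : ℕ) :
    chainPosition x (gridIncrement X T k) i ω = fun j => X j (T / k * i) ω := by
  ext j
  rw [chainPosition, Pi.add_apply, Finset.sum_apply]
  simp only [gridIncrement]
  rw [Finset.sum_range_sub fun i : ℕ => X j (T / k * i) ω]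
  simp [h0]

/-- Along almost every path, the survival of the discretized walks detects non-intersection. -/
lemma eventually_mem_survivalEvent_iff {T : ℝ≥0} {ω : Ω} (h0 : ∀ j, X j 0 ω = x j)
    (hc : ∀ j t, ∀ᶠ s in 𝓝[≥] t, X j s ω = X j t ω) (y : Fin N → ℤ) :
    ∀ᶠ k : ℕ in atTop, (ω ∈ survivalEvent x (gridIncrement X T k) k y ↔
      ω ∈ {ω | (∀ j, X j T ω = y j) ∧ ∀ t, t ≤ T → ∀ i j, i ≠ j → X i t ω ≠ X j t ω}) := by
  have hlast : ∀ {k : ℕ}, 1 ≤ k → T / k * k = T := fun {k} hk =>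
    div_mul_cancel₀ _ (by exact_mod_cast (by omega : k ≠ 0))
  simp only [survivalEvent, Set.mem_ofPred_eq, chainPosition_gridIncrement h0]
  by_cases hcol : ∃ t ≤ T, ∃ i j, i ≠ j ∧ X i t ω = X j t ω
  · obtain ⟨t, ht, i, j, hij, heq⟩ := hcol
    -- Integer-valued right-continuous paths are constant just after `t`, so a collision lasts for a
    -- time `ε` and a fine grid sees it.
    obtain ⟨ε, hε, hball⟩ := Metric.mem_nhdsWithin_iff.1 ((hc i t).and (hc j t))
    have hlim : ∀ᶠ k : ℕ in atTop, (T : ℝ) / k < ε :=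
      (tendsto_const_div_atTop_nhds_zero_nat (T : ℝ)).eventually_lt_const hε
    filter_upwards [hlim, eventually_ge_atTop 1] with k hk hk1
    refine iff_of_false ?_ fun h => h.2 t ht i j hij heq
    rintro ⟨hinj, -⟩
    obtain ⟨l, hl, hl1, hl2⟩ := exists_grid_point T ht hk1
    have hmem : T / k * l ∈ Metric.ball t ε ∩ Set.Ici t := by
      refine ⟨?_, hl1⟩
      have h1 : (t : ℝ) ≤ (T / k * l : ℝ≥0) := by exact_mod_cast hl1
      have h2 : ((T / k * l : ℝ≥0) : ℝ) ≤ t + T / k := by exact_mod_cast hl2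
      rw [Metric.mem_ball, NNReal.dist_eq, abs_of_nonneg (by linarith)]
      linarith
    obtain ⟨hi, hj⟩ := hball hmem
    exact hij (hinj l hl (by simp only [hi, hj, heq]))
  · push Not at hcol
    filter_upwards [eventually_ge_atTop 1] with k hk
    rw [hlast hk, funext_iff]
    constructor
    · exact fun h => ⟨h.2, fun t ht i j => hcol t ht i j⟩
    · refine fun h => ⟨fun i hi a b hab => ?_, h.1⟩
      by_contra hne
      refine hcol _ ?_ a b hne hab
      calc T / k * i ≤ T / k * k := by gcongr
        _ = T := hlast hk

variable [MeasurableSpace Ω] {μ : Measure Ω}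

lemma IsContinuousTimeRandomWalk.ae_start {X : ℝ≥0 → Ω → ℤ} {x : ℤ}
    (h : IsContinuousTimeRandomWalk X x μ) : ∀ᵐ ω ∂μ, X 0 ω = x := by
  obtain ⟨N₁, N₂, h1, h2, -, hX⟩ := h
  filter_upwards [h1.start, h2.start] with ω hω1 hω2
  rw [hX, hω1, hω2]
  simp

lemma IsContinuousTimeRandomWalk.ae_rightCont {X : ℝ≥0 → Ω → ℤ} {x : ℤ}
    (h : IsContinuousTimeRandomWalk X x μ) :
    ∀ᵐ ω ∂μ, ∀ t, ∀ᶠ s in 𝓝[≥] t, X s ω = X t ω := by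
  obtain ⟨N₁, N₂, h1, h2, -, hX⟩ := h
  filter_upwards [h1.rightCont, h2.rightCont] with ω hω1 hω2 t
  have e1 : ∀ᶠ s in 𝓝[≥] t, N₁ s ω = N₁ t ω := by simpa using (hω1 t).tendsto
  have e2 : ∀ᶠ s in 𝓝[≥] t, N₂ s ω = N₂ t ω := by simpa using (hω2 t).tendsto
  filter_upwards [e1, e2] with s hs1 hs2
  rw [hX, hX, hs1, hs2]

lemma IsIndepRandomWalks.measurable_gridIncrement (h : IsIndepRandomWalks X x μ) (T : ℝ≥0)
    (k i : ℕ) : Measurable (gridIncrement X T k i) :=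
  measurable_pi_lambda _ fun j => ((h.walk j).measurable _).sub ((h.walk j).measurable _)

lemma IsIndepRandomWalks.tendsto_survivalEvent [IsFiniteMeasure μ] (h : IsIndepRandomWalks X x μ)
    (T : ℝ≥0) (y : Fin N → ℤ) :
    Tendsto (fun k : ℕ => μ.real (survivalEvent x (gridIncrement X T k) k y)) atTop
      (𝓝 (nonIntersectionProb μ X y T)) := by
  set A : ℕ → Set Ω := fun k => survivalEvent x (gridIncrement X T k) k y with hA
  have hAm : ∀ k, MeasurableSet (A k) := fun k =>
    measurableSet_survivalEvent (h.measurable_gridIncrement T k) k y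
  have hae : ∀ᵐ ω ∂μ, ∀ᶠ k : ℕ in atTop, (ω ∈ A k ↔
      ω ∈ {ω | (∀ j, X j T ω = y j) ∧ ∀ t, t ≤ T → ∀ i j, i ≠ j → X i t ω ≠ X j t ω}) := by
    have hs : ∀ᵐ ω ∂μ, ∀ j, X j 0 ω = x j := ae_all_iff.2 fun j => (h.walk j).ae_start
    have hr : ∀ᵐ ω ∂μ, ∀ j t, ∀ᶠ s in 𝓝[≥] t, X j s ω = X j t ω :=
      ae_all_iff.2 fun j => (h.walk j).ae_rightCont
    filter_upwards [hs, hr] with ω h1 h2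
    exact eventually_mem_survivalEvent_iff h1 h2 y
  -- The non-intersection event involves uncountably many times, so its measurability is not
  -- evident; this measurable set agrees with it almost everywhere.
  set L : Set Ω := {ω | ∀ᶠ k in atTop, ω ∈ A k} with hL
  have hLm : MeasurableSet L := by
    have : L = ⋃ m, ⋂ k ≥ m, A k := by
      ext ω
      simp [hL, eventually_atTop]
    rw [this]
    exact .iUnion fun m => .iInter fun k => .iInter fun _ => hAm k
  have hiff : ∀ᵐ ω ∂μ, (ω ∈ L ↔
      ω ∈ {ω | (∀ j, X j T ω = y j) ∧ ∀ t, t ≤ T → ∀ i j, i ≠ j → X i t ω ≠ X j t ω}) := by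
    filter_upwards [hae] with ω hω
    rw [hL, Set.mem_ofPred_eq, eventually_congr hω, eventually_const]
  have hlim : Tendsto (fun k => μ (A k)) atTop (𝓝 (μ L)) := by
    refine tendsto_measure_of_ae_tendsto_indicator_of_isFiniteMeasure atTop hLm hAm ?_
    filter_upwards [hae, hiff] with ω h1 h2
    filter_upwards [h1] with k hk
    rw [hk, h2]
  have hEL : nonIntersectionProb μ X y T = μ.real L := by
    rw [nonIntersectionProb]
    refine congrArg ENNReal.toReal (measure_congr ?_)
    filter_upwards [hiff] with ω hω
    exact propext hω.symm
  rw [hEL]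
  exact (ENNReal.tendsto_toReal (measure_ne_top _ _)).comp hlim

end Grid

/-! ### The series for the non-intersection probability -/

section Main

open Filter Topology

variable {n : ℕ} {Ω : Type*} [MeasurableSpace Ω] {μ : Measure Ω} [IsProbabilityMeasure μ]
  {X : Fin (n + 1) → ℝ≥0 → Ω → ℤ} {x : Fin (n + 1) → ℤ}

lemma one_sub_exp_mul_le {a : ℝ} (ha : 0 ≤ a) : 1 - Real.exp (-a) * (1 + a) ≤ a ^ 2 := by
  nlinarith [mul_le_mul_of_nonneg_right (Real.add_one_le_exp (-a)) (by linarith : 0 ≤ 1 + a)]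

/-- The non-intersection probability as a series over the number of jumps. -/
theorem nonIntersectionProb_eq_tsum (h : IsIndepRandomWalks X x μ) (hx : ∀ j, x j = (j : ℤ) + 1)
    (T : ℝ≥0) (v : Fin (n + 1) → ℤ) :
    nonIntersectionProb μ X (x + v) T
      = Real.exp (-((n + 1 : ℕ) * T)) * ∑' m, ((T : ℝ) / 2) ^ m / m ! * walkCount m v := by
  have hlim := (h.tendsto_survivalEvent T (x + v)).sub (tendsto_lazyWalkWeight T.coe_nonneg v)
  refine sub_eq_zero.1 (tendsto_nhds_unique hlim ?_)
  have hzero : Tendsto (fun k : ℕ => ((n + 1 : ℕ) * T : ℝ) ^ 2 / k) atTop (𝓝 0) :=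
    tendsto_const_div_atTop_nhds_zero_nat _
  refine tendsto_of_tendsto_of_tendsto_of_le_of_le' tendsto_const_nhds hzero
    (Eventually.of_forall fun k => ?_) ?_
  all_goals
    have key : ∀ k : ℕ, _ := fun k => survivalEvent_sub_lazyWalkWeight (x := x)
      (V := gridIncrement X T k) (h.measurable_gridIncrement T k)
      (h.iIndepFun_increment (t := fun i => T / k * (i : ℕ)) fun a b hab => by
        dsimp only; gcongr) hx
      (c₀ := Real.exp (-((n + 1 : ℕ) * ((T : ℝ) / k))))
      (c₁ := Real.exp (-((n + 1 : ℕ) * ((T : ℝ) / k))) * ((T : ℝ) / k / 2))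
      (by positivity) (by positivity)
      (fun i => by
        have := h.exp_le_measureReal_increment_zero (s := T / k * i) (t := T / k * (i + 1 : ℕ))
          (by gcongr; omega)
        refine le_trans (le_of_eq ?_) this
        congr 3
        push_cast
        ring)
      (fun i e => by
        have := h.exp_le_measureReal_increment_step (s := T / k * i) (t := T / k * (i + 1 : ℕ))
          (by gcongr; omega) e
        refine le_trans (le_of_eq ?_) this
        rw [show (((T / k * (i + 1 : ℕ) : ℝ≥0) : ℝ) - (T / k * i : ℝ≥0)) = T / k by
          push_cast; ring]) k v
  · exact (key k).1
  · filter_upwards [eventually_ge_atTop 1] with k hk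
    have hk' : (0 : ℝ) < k := by exact_mod_cast hk
    refine (key k).2.trans ?_
    -- With `a = (n + 1) * T / k`, the lazy moves miss mass at most `a ^ 2` in each grid step, hence
    -- `O(1 / k)` over `k` steps.
    have h1 := one_sub_exp_mul_le (a := (n + 1 : ℕ) * ((T : ℝ) / k)) (by positivity)
    calc (k : ℝ) * _ ≤ k * ((n + 1 : ℕ) * ((T : ℝ) / k)) ^ 2 := by
          refine mul_le_mul_of_nonneg_left (le_trans (le_of_eq ?_) h1) hk'.le
          push_cast
          ring
      _ = _ := by
          field_simp

end Main

theorem theorem1p1 (M : ℝ) (b : ℕ) :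
    ∃ (C : ℝ) (n₀ : ℕ), ∀ (n : ℕ), n₀ ≤ n →
      ∀ (Ω : Type*) [MeasurableSpace Ω] (μ : Measure Ω) [IsProbabilityMeasure μ]
        (X : Fin (n + 2) → ℝ≥0 → Ω → ℤ) (x y : Fin (n + 2) → ℤ) (T : ℝ≥0) (β₁ β₂ : ℕ),
        IsIndepRandomWalks X x μ →
        (∀ j, x j = (j : ℤ) + 1) →
        (∀ k : Fin (n + 2), (k : ℕ) < n → y k = (k : ℤ) + 1) →
        y ⟨n, by omega⟩ = (n : ℤ) + β₁ →
        y ⟨n + 1, by omega⟩ = (n : ℤ) + β₂ →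
        0 < β₁ → β₁ < β₂ → β₂ ≤ b → (T : ℝ) ≤ M →
        ∃ ε : ℝ, |ε| ≤ C / (n : ℝ) ^ 2 ∧
          nonIntersectionProb μ X y T =
            Real.exp (-((n : ℝ) + 2) * T) * ((T : ℝ) / 2) ^ (β₁ + β₂ - 3) *
              Real.exp ((T : ℝ) ^ 2 / 4) / (((β₁ - 1)! : ℝ) * ((β₂ - 1)! : ℝ)) *
              ((β₂ : ℝ) - (β₁ : ℝ)) * (1 + ε) := by
  -- The series is evaluated at `c = T / 2 ≤ M / 2`. The norm of the displacement is at most `2 *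
  -- b`, so `8 * b ≤ n` suffices; the extra `1` makes `n` positive.
  refine ⟨16 * ∑' r : ℕ, (r : ℝ) ^ 2 * (((M / 2) ^ 2) ^ r / (r ! : ℝ)), 8 * b + 1, ?_⟩
  intro n hn Ω _ μ _ X x y T β₁ β₂ h hx hy hy₁ hy₂ hβ₁ hβ hb hT
  -- The last two walks start at `n + 1` and `n + 2`, so their displacements are `p = β₁ - 1` and `q
  -- = β₂ - 2`.
  obtain ⟨p, rfl⟩ := Nat.exists_eq_add_of_le' (Nat.succ_le_of_lt hβ₁)
  obtain ⟨q, rfl⟩ := Nat.exists_eq_add_of_le' (show 2 ≤ β₂ by omega)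
  have hpq : p ≤ q := by omega
  have hyv : y = x + twoRow n p q := by
    ext j
    rw [Pi.add_apply, hx, twoRow]
    rcases lt_or_ge (j : ℕ) n with hj | hj
    · rw [if_pos hj, hy j hj, add_zero]
    · rw [if_neg (by omega)]
      split_ifs with hj'
      · have : j = ⟨n, by omega⟩ := Fin.ext hj'
        rw [this, hy₁]
        push_cast
        ring
      · have : j = ⟨n + 1, by omega⟩ := Fin.ext (by simp only; omega)
        rw [this, hy₂]
        push_cast
        ring
  obtain ⟨ε, hε, hsum⟩ := exists_tsum_walkCount_eq (v := twoRow n p q)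
    (geodesicCount_twoRow_pos n hpq) (b := 2 * b) (by rw [latticeNorm_twoRow]; omega)
    (by omega : 4 * (2 * b) ≤ n + 1) (c := T / 2) (M := M / 2) (by positivity) (by linarith)
    n.succ_pos
  refine ⟨ε, hε.trans ?_, ?_⟩
  · have hn0 : (0 : ℝ) < n := by exact_mod_cast (by omega : 0 < n)
    have hS : (0 : ℝ) ≤ ∑' r : ℕ, (r : ℝ) ^ 2 * (((M / 2) ^ 2) ^ r / (r ! : ℝ)) :=
      tsum_nonneg fun r => by positivity
    gcongr
    simp
  · rw [hyv, nonIntersectionProb_eq_tsum h hx, hsum, latticeNorm_twoRow,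
      geodesicCount_twoRow n (by omega), show p + 1 + (q + 2) - 3 = p + q by omega,
      show ((T : ℝ) / 2) ^ 2 = (T : ℝ) ^ 2 / 4 by ring,
      show -(((n + 1 + 1 : ℕ) : ℝ) * T) = -((n : ℝ) + 2) * T by push_cast; ring,
      Nat.add_sub_cancel, show q + 2 - 1 = q + 1 by omega]
    push_cast
    field_simp
    ring
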